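/- Let $\Bbbk$ be an algebraically closed field of characteristic $0$, and let $\sqrt{-1}\in\Bbbk$ be a fixed square root of $-1$. The Kac–Paljutkin Hopf algebra $H_8$ over $\Bbbk$ is the algebra generated by $g,h,z$ with relations $$g^2=h^2=1,\quad z^2=\tfrac12(1+g+h-gh),\quad gh=hg,\quad zg=hz,\quad zh=gz,$$ with basis $\{1,g,h,gh,z,gz,hz,ghz\}$ and with $\Delta(g)=g\otimes g$, $\Delta(h)=h\otimes h$, $\Delta(z)=\tfrac12(1\otimes1+g\otimes1+1\otimes h-g\otimes h)(z\otimes z)$, $\varepsilon(g)=\varepsilon(h)=\varepsilon(z)=1$, and $S(g)=g$, $S(h)=h$, $S(z)=z$ ($S$ an algebra anti-homomorphism). Write $\Delta(x)=x_1\otimes x_2$. A *matched pair of actions* on a Hopf algebra $H$ is a pair of linear maps $\rightharpoonup,\leftharpoonup\colon H\otimes H\to H$ such that $\rightharpoonup$ is a left module action of $H$ on $H$, $\leftharpoonup$ is a right module action of $H$ on $H$, both maps are coalgebra homomorphisms, and for all $x,y,a,b\in H$ $$x\rightharpoonup ab=(x_1\rightharpoonup a_1)\big((x_2\leftharpoonup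 a_2)\rightharpoonup b\big),\qquad x\rightharpoonup 1=\varepsilon(x)1,$$ $$xy\leftharpoonup a=\big(x\leftharpoonup(y_1\rightharpoonup a_1)\big)(y_2\leftharpoonup a_2),\qquad 1\leftharpoonup a=\varepsilon(a)1,$$ $$(x_1\rightharpoonup a_1)\otimes(x_2\leftharpoonup a_2)=(x_2\rightharpoonup a_2)\otimes(x_1\leftharpoonup a_1),\qquad xy=(x_1\rightharpoonup y_1)(x_2\leftharpoonup y_2).$$ **Theorem.** There are exactly $6$ matched pairs of actions $(\rightharpoonup,\leftharpoonup)$ on $H_8$. They are the pairs in which $\rightharpoonup$ is one of the six bilinear maps below and $\leftharpoonup$ is given by $x\leftharpoonup y=S(x_1\rightharpoonup y_1)\,x_2y_2$ for all $x,y\in H_8$. Here $K,L$ range over $G=\{1,g,h,gh\}$. * Four maps with $z\rightharpoonup g=g$: put $c(1)=c(gh)=1$ and $c(g)=c(h)=gh$. Then $$K\rightharpoonup L=L,\quad Kz\rightharpoonup L=L,\quad K\rightharpoonup Lz=c(K)\,L\,z,\quad Kz\rightharpoonup Lz=c(K)\,L\,w,$$ where $w=z\rightharpoonup z$ is one of $$\tfrac{1-\sqrt{-1}}2gz+\tfrac{1+\sqrt{-1}}2hz,\quad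 \tfrac{1+\sqrt{-1}}2gz+\tfrac{1-\sqrt{-1}}2hz,\quad \tfrac{1-\sqrt{-1}}2z+\tfrac{1+\sqrt{-1}}2ghz,\quad \tfrac{1+\sqrt{-1}}2z+\tfrac{1-\sqrt{-1}}2ghz.$$ * Two maps with $z\rightharpoonup g=h$: let $\sigma$ be the automorphism of $G$ exchanging $g$ and $h$. Then $$K\rightharpoonup L=L,\quad Kz\rightharpoonup L=\sigma(L),\quad K\rightharpoonup Lz=Lz,\quad Kz\rightharpoonup Lz=\sigma(L)\,w,$$ where $w=z\rightharpoonup z$ is one of $z^3$ and $ghz^3$. -/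

import Mathlib

open scoped TensorProduct

noncomputable section

/-! ### Matched pairs of Hopf algebras and matched pairs of actions

An action `⇀ : H ⊗ K → K` is stored as a bilinear map `l`, with `x ⇀ a = l x a`, and an action
`↼ : H ⊗ K → H` as a bilinear map `r`, with `x ↼ a = r x a`.
`Coalgebra.comul (x ⊗ₜ a)` is taken in the tensor product coalgebra `H ⊗ K`; in Sweedler notation
it is `∑ (x₁ ⊗ a₁) ⊗ (x₂ ⊗ a₂)`. -/

/-- `(H, K, ⇀, ↼)` is a matched pair of Hopf algebras. -/
structure IsMatchedPair (k : Type*) {H K : Type*} [Field k] [Ring H] [Ring K]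
    [HopfAlgebra k H] [HopfAlgebra k K]
    (l : H →ₗ[k] K →ₗ[k] K) (r : H →ₗ[k] K →ₗ[k] H) : Prop where
  /-- `1 ⇀ a = a` -/
  one_left : ∀ a : K, l 1 a = a
  /-- `xy ⇀ a = x ⇀ (y ⇀ a)` -/
  mul_left : ∀ (x y : H) (a : K), l (x * y) a = l x (l y a)
  /-- `ε(x ⇀ a) = ε(x) ε(a)` -/
  counit_left : ∀ (x : H) (a : K),
    Coalgebra.counit (R := k) (l x a) =
      Coalgebra.counit (R := k) x * Coalgebra.counit (R := k) a
  /-- `Δ(x ⇀ a) = (x₁ ⇀ a₁) ⊗ (x₂ ⇀ a₂)` -/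
  comul_left : ∀ (x : H) (a : K),
    Coalgebra.comul (R := k) (l x a) =
      TensorProduct.map (TensorProduct.lift l) (TensorProduct.lift l)
        (Coalgebra.comul (R := k) (x ⊗ₜ[k] a))
  /-- `x ↼ 1 = x` -/
  one_right : ∀ x : H, r x 1 = x
  /-- `x ↼ ab = (x ↼ a) ↼ b` -/
  mul_right : ∀ (x : H) (a b : K), r x (a * b) = r (r x a) b
  /-- `ε(x ↼ a) = ε(x) ε(a)` -/
  counit_right : ∀ (x : H) (a : K),
    Coalgebra.counit (R := k) (r x a) =
      Coalgebra.counit (R := k) x * Coalgebra.counit (R := k) a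
  /-- `Δ(x ↼ a) = (x₁ ↼ a₁) ⊗ (x₂ ↼ a₂)` -/
  comul_right : ∀ (x : H) (a : K),
    Coalgebra.comul (R := k) (r x a) =
      TensorProduct.map (TensorProduct.lift r) (TensorProduct.lift r)
        (Coalgebra.comul (R := k) (x ⊗ₜ[k] a))
  /-- `x ⇀ ab = (x₁ ⇀ a₁) ((x₂ ↼ a₂) ⇀ b)` -/
  left_mul : ∀ (x : H) (a b : K),
    l x (a * b) =
      LinearMap.mul' k K
        (TensorProduct.map (TensorProduct.lift l) (l.flip b ∘ₗ TensorProduct.lift r)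
          (Coalgebra.comul (R := k) (x ⊗ₜ[k] a)))
  /-- `x ⇀ 1 = ε(x) 1` -/
  left_one : ∀ x : H, l x 1 = Coalgebra.counit (R := k) x • (1 : K)
  /-- `xy ↼ a = (x ↼ (y₁ ⇀ a₁)) (y₂ ↼ a₂)` -/
  right_mul : ∀ (x y : H) (a : K),
    r (x * y) a =
      LinearMap.mul' k H
        (TensorProduct.map (r x ∘ₗ TensorProduct.lift l) (TensorProduct.lift r)
          (Coalgebra.comul (R := k) (y ⊗ₜ[k] a)))
  /-- `1 ↼ a = ε(a) 1` -/
  right_one : ∀ a : K, r 1 a = Coalgebra.counit (R := k) a • (1 : H)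
  /-- `(x₁ ⇀ a₁) ⊗ (x₂ ↼ a₂) = (x₂ ⇀ a₂) ⊗ (x₁ ↼ a₁)` -/
  compat : ∀ (x : H) (a : K),
    TensorProduct.map (TensorProduct.lift l) (TensorProduct.lift r)
        (Coalgebra.comul (R := k) (x ⊗ₜ[k] a)) =
      TensorProduct.comm k H K
        (TensorProduct.map (TensorProduct.lift r) (TensorProduct.lift l)
          (Coalgebra.comul (R := k) (x ⊗ₜ[k] a)))

/-- `(H, ⇀, ↼)` is a matched pair of actions on `H`. -/
structure IsMatchedPairOfActions (k : Type*) {H : Type*} [Field k] [Ring H] [HopfAlgebra k H]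
    (l r : H →ₗ[k] H →ₗ[k] H) : Prop extends IsMatchedPair k l r where
  /-- `xy = (x₁ ⇀ y₁) (x₂ ↼ y₂)` -/
  mul_eq : ∀ x y : H,
    x * y =
      LinearMap.mul' k H
        (TensorProduct.map (TensorProduct.lift l) (TensorProduct.lift r)
          (Coalgebra.comul (R := k) (x ⊗ₜ[k] y)))

/-- The bilinear map `x ↼ y = S(x₁ ⇀ y₁) x₂ y₂` determined by `⇀`. -/
def inducedRight (k : Type*) {H : Type*} [Field k] [Ring H] [HopfAlgebra k H]
    (l : H →ₗ[k] H →ₗ[k] H) : H →ₗ[k] H →ₗ[k] H :=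
  TensorProduct.curry
    (LinearMap.mul' k H ∘ₗ
      TensorProduct.map (HopfAlgebra.antipode k ∘ₗ TensorProduct.lift l) (LinearMap.mul' k H) ∘ₗ
        Coalgebra.comul (R := k) (A := H ⊗[k] H))

/-! ### The Kac–Paljutkin algebra -/

/-- Names of the three generators. -/
inductive H8Gen : Type
  | g
  | h
  | z

/-- The defining relations
`g² = h² = 1`, `z² = ½(1 + g + h - gh)`, `gh = hg`, `zg = hz`, `zh = gz`. -/
inductive H8Rel (k : Type*) [Field k] : FreeAlgebra k H8Gen → FreeAlgebra k H8Gen → Prop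
  | g_sq : H8Rel k (FreeAlgebra.ι k H8Gen.g * FreeAlgebra.ι k H8Gen.g) 1
  | h_sq : H8Rel k (FreeAlgebra.ι k H8Gen.h * FreeAlgebra.ι k H8Gen.h) 1
  | z_sq : H8Rel k (FreeAlgebra.ι k H8Gen.z * FreeAlgebra.ι k H8Gen.z)
      ((1 / 2 : k) • (1 + FreeAlgebra.ι k H8Gen.g + FreeAlgebra.ι k H8Gen.h -
        FreeAlgebra.ι k H8Gen.g * FreeAlgebra.ι k H8Gen.h))
  | g_h : H8Rel k (FreeAlgebra.ι k H8Gen.g * FreeAlgebra.ι k H8Gen.h)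
      (FreeAlgebra.ι k H8Gen.h * FreeAlgebra.ι k H8Gen.g)
  | z_g : H8Rel k (FreeAlgebra.ι k H8Gen.z * FreeAlgebra.ι k H8Gen.g)
      (FreeAlgebra.ι k H8Gen.h * FreeAlgebra.ι k H8Gen.z)
  | z_h : H8Rel k (FreeAlgebra.ι k H8Gen.z * FreeAlgebra.ι k H8Gen.h)
      (FreeAlgebra.ι k H8Gen.g * FreeAlgebra.ι k H8Gen.z)

/-- The Kac–Paljutkin algebra `H₈` over `k`, as the algebra presented by the generators `g, h, z`
and the relations `H8Rel`. -/
def H8 (k : Type*) [Field k] : Type _ := RingQuot (H8Rel k)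

namespace H8

section Alg

variable (k : Type*) [Field k]

instance : Ring (H8 k) := inferInstanceAs (Ring (RingQuot (H8Rel k)))

instance : Algebra k (H8 k) := inferInstanceAs (Algebra k (RingQuot (H8Rel k)))

/-- The quotient map from the free algebra. -/
def mk : FreeAlgebra k H8Gen →ₐ[k] H8 k := RingQuot.mkAlgHom k (H8Rel k)

/-- The generator `g`. -/
def g : H8 k := mk k (FreeAlgebra.ι k H8Gen.g)

/-- The generator `h`. -/
def h : H8 k := mk k (FreeAlgebra.ι k H8Gen.h)

/-- The generator `z`. -/
def z : H8 k := mk k (FreeAlgebra.ι k H8Gen.z)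

lemma mk_rel {a b : FreeAlgebra k H8Gen} (hab : H8Rel k a b) : mk k a = mk k b :=
  RingQuot.mkAlgHom_rel k hab

lemma g_mul_g : g k * g k = 1 := by
  simpa [g] using mk_rel k H8Rel.g_sq

lemma h_mul_h : h k * h k = 1 := by
  simpa [h] using mk_rel k H8Rel.h_sq

lemma z_mul_z : z k * z k = (1 / 2 : k) • (1 + g k + h k - g k * h k) := by
  simpa only [g, h, z, map_mul, map_smul, map_add, map_sub, map_one] using mk_rel k H8Rel.z_sq

lemma h_mul_g : h k * g k = g k * h k := by
  simpa only [g, h, map_mul] using (mk_rel k H8Rel.g_h).symm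

lemma z_mul_g : z k * g k = h k * z k := by
  simpa only [g, h, z, map_mul] using mk_rel k H8Rel.z_g

lemma z_mul_h : z k * h k = g k * z k := by
  simpa only [g, h, z, map_mul] using mk_rel k H8Rel.z_h

lemma g_mul_g_assoc (x : H8 k) : g k * (g k * x) = x := by
  rw [← mul_assoc, g_mul_g, one_mul]

lemma h_mul_h_assoc (x : H8 k) : h k * (h k * x) = x := by
  rw [← mul_assoc, h_mul_h, one_mul]

lemma h_mul_g_assoc (x : H8 k) : h k * (g k * x) = g k * (h k * x) := by
  rw [← mul_assoc, h_mul_g, mul_assoc]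

lemma z_mul_g_assoc (x : H8 k) : z k * (g k * x) = h k * (z k * x) := by
  rw [← mul_assoc, z_mul_g, mul_assoc]

lemma z_mul_h_assoc (x : H8 k) : z k * (h k * x) = g k * (z k * x) := by
  rw [← mul_assoc, z_mul_h, mul_assoc]

variable {k}

/-- Induction over the words in the generators. -/
lemma induction {P : H8 k → Prop} (hc : ∀ c : k, P (algebraMap k (H8 k) c))
    (hg : P (g k)) (hh : P (h k)) (hz : P (z k))
    (hmul : ∀ a b, P a → P b → P (a * b)) (hadd : ∀ a b, P a → P b → P (a + b))
    (x : H8 k) : P x := by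
  obtain ⟨y, rfl⟩ := RingQuot.mkAlgHom_surjective k (H8Rel k) x
  change P (mk k y)
  induction y using FreeAlgebra.induction with
  | grade0 c => rw [AlgHom.commutes]; exact hc c
  | grade1 t => cases t <;> assumption
  | mul a b ha hb => rw [map_mul]; exact hmul _ _ ha hb
  | add a b ha hb => rw [map_add]; exact hadd _ _ ha hb

/-- The universal property of the presentation. -/
def lift {A : Type*} [Ring A] [Algebra k A] (a b c : A) (haa : a * a = 1) (hbb : b * b = 1)
    (hcc : c * c = (1 / 2 : k) • (1 + a + b - a * b)) (hab : a * b = b * a)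
    (hca : c * a = b * c) (hcb : c * b = a * c) : H8 k →ₐ[k] A :=
  RingQuot.liftAlgHom k
    ⟨FreeAlgebra.lift k (fun t : H8Gen => match t with
        | H8Gen.g => a
        | H8Gen.h => b
        | H8Gen.z => c), by
      intro x y hxy
      cases hxy <;> simp_all⟩

section lift

variable {A : Type*} [Ring A] [Algebra k A] (a b c : A) (haa : a * a = 1) (hbb : b * b = 1)
    (hcc : c * c = (1 / 2 : k) • (1 + a + b - a * b)) (hab : a * b = b * a)
    (hca : c * a = b * c) (hcb : c * b = a * c)

lemma lift_g : lift a b c haa hbb hcc hab hca hcb (g k) = a := by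
  unfold lift g mk
  erw [RingQuot.liftAlgHom_mkAlgHom_apply]
  simp

lemma lift_h : lift a b c haa hbb hcc hab hca hcb (h k) = b := by
  unfold lift h mk
  erw [RingQuot.liftAlgHom_mkAlgHom_apply]
  simp

lemma lift_z : lift a b c haa hbb hcc hab hca hcb (z k) = c := by
  unfold lift z mk
  erw [RingQuot.liftAlgHom_mkAlgHom_apply]
  simp

end lift

lemma algHom_ext {A : Type*} [Semiring A] [Algebra k A] {φ ψ : H8 k →ₐ[k] A}
    (hg : φ (g k) = ψ (g k)) (hh : φ (h k) = ψ (h k)) (hz : φ (z k) = ψ (z k)) : φ = ψ := by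
  ext x
  induction x using H8.induction with
  | hc c => simp
  | hg => exact hg
  | hh => exact hh
  | hz => exact hz
  | hmul a b ha hb => simp [ha, hb]
  | hadd a b ha hb => simp [ha, hb]

end Alg

/-! #### The basis `1, g, h, gh, z, gz, hz, ghz` -/

section Basis

variable (k : Type*) [Field k]

/-- The eight monomials `1, g, h, gh, z, gz, hz, ghz`. -/
def monomial : Fin 8 → H8 k :=
  ![1, g k, h k, g k * h k, z k, g k * z k, h k * z k, g k * h k * z k]

/-- Left multiplication by `g` in coordinates. -/
def coordG : Module.End k (Fin 8 → k) where
  toFun v := ![v 1, v 0, v 3, v 2, v 5, v 4, v 7, v 6]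
  map_add' u v := by ext t; fin_cases t <;> rfl
  map_smul' c v := by ext t; fin_cases t <;> rfl

/-- Left multiplication by `h` in coordinates. -/
def coordH : Module.End k (Fin 8 → k) where
  toFun v := ![v 2, v 3, v 0, v 1, v 6, v 7, v 4, v 5]
  map_add' u v := by ext t; fin_cases t <;> rfl
  map_smul' c v := by ext t; fin_cases t <;> rfl

/-- Left multiplication by `z` in coordinates. -/
def coordZ : Module.End k (Fin 8 → k) where
  toFun v := ![(v 4 + v 6 + v 5 - v 7) / 2, (v 6 + v 4 + v 7 - v 5) / 2,
    (v 5 + v 7 + v 4 - v 6) / 2, (v 7 + v 5 + v 6 - v 4) / 2, v 0, v 2, v 1, v 3]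
  map_add' u v := by ext t; fin_cases t <;> simp <;> ring
  map_smul' c v := by ext t; fin_cases t <;> simp <;> ring

/-- The left regular representation in coordinates. -/
def coordRep [CharZero k] : H8 k →ₐ[k] Module.End k (Fin 8 → k) :=
  lift (coordG k) (coordH k) (coordZ k)
    (by refine LinearMap.ext fun v => funext fun t => ?_
        fin_cases t <;> simp [coordG])
    (by refine LinearMap.ext fun v => funext fun t => ?_
        fin_cases t <;> simp [coordH])
    (by refine LinearMap.ext fun v => funext fun t => ?_
        fin_cases t <;> simp [coordG, coordH, coordZ, Matrix.vecHead, Matrix.vecTail] <;> ring)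
    (by refine LinearMap.ext fun v => funext fun t => ?_
        fin_cases t <;> simp [coordG, coordH])
    (by refine LinearMap.ext fun v => funext fun t => ?_
        fin_cases t <;> simp [coordG, coordH, coordZ])
    (by refine LinearMap.ext fun v => funext fun t => ?_
        fin_cases t <;> simp [coordG, coordH, coordZ])

lemma coordRep_monomial [CharZero k] (m : Fin 8) :
    coordRep k (monomial k m) (Pi.single 0 1) = Pi.single m 1 := by
  funext t
  fin_cases m <;> fin_cases t <;>
    simp [monomial, coordRep, lift_g, lift_h, lift_z, coordG, coordH, coordZ]

lemma linearIndependent_monomial [CharZero k] : LinearIndependent k (monomial k) := by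
  let F : H8 k →ₗ[k] (Fin 8 → k) :=
    (LinearMap.applyₗ (Pi.single 0 1 : Fin 8 → k)) ∘ₗ (coordRep k).toLinearMap
  have hF : F ∘ monomial k = fun m => Pi.single m (1 : k) := by
    funext m
    exact coordRep_monomial k m
  refine LinearIndependent.of_comp F ?_
  rw [hF]
  have hb : (fun m => Pi.single m (1 : k)) = ⇑(Pi.basisFun k (Fin 8)) := by
    funext m
    simp
  rw [hb]
  exact (Pi.basisFun k (Fin 8)).linearIndependent

lemma top_le_span_monomial : ⊤ ≤ Submodule.span k (Set.range (monomial k)) := by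
  obtain ⟨M, hM⟩ : ∃ M, M = Submodule.span k (Set.range (monomial k)) := ⟨_, rfl⟩
  have hmem : ∀ m, monomial k m ∈ M := fun m => hM ▸ Submodule.subset_span ⟨m, rfl⟩
  rw [← hM]
  have key : ∀ x : H8 k, ∀ y ∈ M, x * y ∈ M := by
    have ext1 : ∀ x : H8 k, (∀ m, x * monomial k m ∈ M) → ∀ y ∈ M, x * y ∈ M := by
      intro x hx y hy
      rw [hM] at hy
      induction hy using Submodule.span_induction with
      | mem y hy => obtain ⟨m, rfl⟩ := hy; exact hx m
      | zero => simp
      | add a b _ _ ha hb => rw [mul_add]; exact M.add_mem ha hb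
      | smul c a _ ha => rw [mul_smul_comm]; exact M.smul_mem c ha
    have h0 : (1 : H8 k) ∈ M := hmem 0
    have h1 : g k ∈ M := hmem 1
    have h2 : h k ∈ M := hmem 2
    have h3 : g k * h k ∈ M := hmem 3
    have h4 : z k ∈ M := hmem 4
    have h5 : g k * z k ∈ M := hmem 5
    have h6 : h k * z k ∈ M := hmem 6
    have h7 : g k * (h k * z k) ∈ M := by rw [← mul_assoc]; exact hmem 7
    intro x
    induction x using H8.induction with
    | hc c => intro y hy; rw [← Algebra.smul_def]; exact M.smul_mem c hy
    | hg =>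
      refine ext1 _ fun m => ?_
      fin_cases m <;> simpa [monomial, mul_assoc, g_mul_g, g_mul_g_assoc]
    | hh =>
      refine ext1 _ fun m => ?_
      fin_cases m <;>
        simpa [monomial, mul_assoc, h_mul_h, h_mul_h_assoc, h_mul_g, h_mul_g_assoc]
    | hz =>
      have hs : ∀ a b c d : H8 k, a ∈ M → b ∈ M → c ∈ M → d ∈ M →
          (1 / 2 : k) • (a + b + c - d) ∈ M := fun a b c d ha hb hc hd =>
        M.smul_mem _ (M.sub_mem (M.add_mem (M.add_mem ha hb) hc) hd)
      refine ext1 _ fun m => ?_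
      fin_cases m
      · simpa [monomial]
      · simpa [monomial, z_mul_g]
      · simpa [monomial, z_mul_h]
      · simpa [monomial, z_mul_g_assoc, z_mul_h, h_mul_g_assoc]
      · change z k * z k ∈ M
        rw [z_mul_z]
        exact hs _ _ _ _ h0 h1 h2 h3
      · change z k * (g k * z k) ∈ M
        rw [z_mul_g_assoc, z_mul_z, mul_smul_comm, mul_sub, mul_add, mul_add, mul_one, h_mul_g,
          h_mul_h, h_mul_g_assoc, h_mul_h, mul_one]
        exact hs _ _ _ _ h2 h3 h0 h1
      · change z k * (h k * z k) ∈ M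
        rw [z_mul_h_assoc, z_mul_z, mul_smul_comm, mul_sub, mul_add, mul_add, mul_one, g_mul_g,
          g_mul_g_assoc]
        exact hs _ _ _ _ h1 h0 h3 h2
      · change z k * (g k * h k * z k) ∈ M
        rw [mul_assoc, z_mul_g_assoc, z_mul_h_assoc, z_mul_z, mul_smul_comm, mul_sub, mul_add,
          mul_add, mul_one, g_mul_g, g_mul_g_assoc, mul_smul_comm, mul_sub, mul_add, mul_add,
          mul_one, h_mul_g, h_mul_h, h_mul_g_assoc, h_mul_h, mul_one]
        exact hs _ _ _ _ h3 h2 h1 h0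
    | hmul a b ha hb => intro y hy; rw [mul_assoc]; exact ha _ (hb _ hy)
    | hadd a b ha hb => intro y hy; rw [add_mul]; exact M.add_mem (ha _ hy) (hb _ hy)
  intro x _
  have := key x 1 (hmem 0)
  rwa [mul_one] at this

/-- The linear basis `1, g, h, gh, z, gz, hz, ghz` of `H₈`. -/
def basis [CharZero k] : Module.Basis (Fin 8) k (H8 k) :=
  Module.Basis.mk (linearIndependent_monomial k) (top_le_span_monomial k)

lemma basis_apply [CharZero k] (m : Fin 8) : basis k m = monomial k m := by
  simp [basis]

end Basis

/-! #### The Hopf algebra structure -/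

section HopfMaps

variable (k : Type*) [Field k]

/-- `J = ½(1 ⊗ 1 + g ⊗ 1 + 1 ⊗ h - g ⊗ h)`. -/
def J : H8 k ⊗[k] H8 k :=
  (1 / 2 : k) • (1 ⊗ₜ 1 + g k ⊗ₜ 1 + 1 ⊗ₜ h k - g k ⊗ₜ h k)

/-- `J (z ⊗ z)` written out. -/
lemma J_mul : J k * (z k ⊗ₜ[k] z k) =
    (1 / 2 : k) • (z k ⊗ₜ z k + (g k * z k) ⊗ₜ z k + z k ⊗ₜ (h k * z k) -
      (g k * z k) ⊗ₜ (h k * z k)) := by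
  simp [J, add_mul, sub_mul]

lemma gg_mul_gg : (g k ⊗ₜ[k] g k) * (g k ⊗ₜ[k] g k) = 1 := by
  simp [g_mul_g, Algebra.TensorProduct.one_def]

lemma hh_mul_hh : (h k ⊗ₜ[k] h k) * (h k ⊗ₜ[k] h k) = 1 := by
  simp [h_mul_h, Algebra.TensorProduct.one_def]

lemma gg_mul_hh : (g k ⊗ₜ[k] g k) * (h k ⊗ₜ[k] h k) = (h k ⊗ₜ[k] h k) * (g k ⊗ₜ[k] g k) := by
  simp [h_mul_g]

lemma J_mul_gg : (J k * (z k ⊗ₜ[k] z k)) * (g k ⊗ₜ[k] g k) =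
    (h k ⊗ₜ[k] h k) * (J k * (z k ⊗ₜ[k] z k)) := by
  simp [J_mul, add_mul, sub_mul, mul_add, mul_sub, mul_assoc, z_mul_g, h_mul_g_assoc]

lemma J_mul_hh : (J k * (z k ⊗ₜ[k] z k)) * (h k ⊗ₜ[k] h k) =
    (g k ⊗ₜ[k] g k) * (J k * (z k ⊗ₜ[k] z k)) := by
  simp [J_mul, add_mul, sub_mul, mul_add, mul_sub, mul_assoc, z_mul_h, h_mul_g_assoc]

/-- `S(g) = g`, `S(h) = h`, `S(z) = z`, extended as an anti-homomorphism of algebras. -/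
def antipodeHom : H8 k →ₐ[k] (H8 k)ᵐᵒᵖ :=
  lift (MulOpposite.op (g k)) (MulOpposite.op (h k)) (MulOpposite.op (z k))
    (by rw [← MulOpposite.op_mul, g_mul_g, MulOpposite.op_one])
    (by rw [← MulOpposite.op_mul, h_mul_h, MulOpposite.op_one])
    (by rw [← MulOpposite.op_mul, z_mul_z, ← MulOpposite.op_mul, h_mul_g]; simp)
    (by rw [← MulOpposite.op_mul, ← MulOpposite.op_mul, h_mul_g])
    (by rw [← MulOpposite.op_mul, ← MulOpposite.op_mul, z_mul_h])
    (by rw [← MulOpposite.op_mul, ← MulOpposite.op_mul, z_mul_g])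

lemma antipodeHom_g : antipodeHom k (g k) = MulOpposite.op (g k) := by rw [antipodeHom, lift_g]
lemma antipodeHom_h : antipodeHom k (h k) = MulOpposite.op (h k) := by rw [antipodeHom, lift_h]
lemma antipodeHom_z : antipodeHom k (z k) = MulOpposite.op (z k) := by rw [antipodeHom, lift_z]

/-- The antipode as a linear map. -/
def antipodeLin : H8 k →ₗ[k] H8 k :=
  (MulOpposite.opLinearEquiv k).symm.toLinearMap ∘ₗ (antipodeHom k).toLinearMap

lemma antipodeLin_g : antipodeLin k (g k) = g k := by simp [antipodeLin, antipodeHom_g]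
lemma antipodeLin_h : antipodeLin k (h k) = h k := by simp [antipodeLin, antipodeHom_h]
lemma antipodeLin_z : antipodeLin k (z k) = z k := by simp [antipodeLin, antipodeHom_z]

lemma antipodeLin_one : antipodeLin k 1 = 1 := by simp [antipodeLin]

lemma antipodeLin_mul (x y : H8 k) :
    antipodeLin k (x * y) = antipodeLin k y * antipodeLin k x := by
  simp [antipodeLin]

end HopfMaps

section Hopf

variable (k : Type*) [Field k] [CharZero k]

lemma J_mul_sq : (J k * (z k ⊗ₜ[k] z k)) * (J k * (z k ⊗ₜ[k] z k)) =
    (1 / 2 : k) • (1 + g k ⊗ₜ[k] g k + h k ⊗ₜ[k] h k -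
      (g k ⊗ₜ[k] g k) * (h k ⊗ₜ[k] h k)) := by
  rw [J_mul, Algebra.TensorProduct.one_def]
  simp only [smul_mul_assoc, mul_smul_comm, add_mul, sub_mul, mul_add, mul_sub,
    Algebra.TensorProduct.tmul_mul_tmul, mul_assoc, z_mul_g_assoc, z_mul_h_assoc,
    z_mul_z, h_mul_h, h_mul_g, h_mul_g_assoc, g_mul_g,
    g_mul_g_assoc, mul_one,
    TensorProduct.tmul_add, TensorProduct.add_tmul, TensorProduct.tmul_sub,
    TensorProduct.sub_tmul, TensorProduct.tmul_smul, ← TensorProduct.smul_tmul']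
  module

/-- `Δ(g) = g ⊗ g`, `Δ(h) = h ⊗ h`, `Δ(z) = J (z ⊗ z)`. -/
def comulHom : H8 k →ₐ[k] H8 k ⊗[k] H8 k :=
  lift (g k ⊗ₜ g k) (h k ⊗ₜ h k) (J k * (z k ⊗ₜ z k))
    (gg_mul_gg k) (hh_mul_hh k) (J_mul_sq k) (gg_mul_hh k) (J_mul_gg k) (J_mul_hh k)

/-- `ε(g) = ε(h) = ε(z) = 1`. -/
def counitHom : H8 k →ₐ[k] k :=
  lift 1 1 1 (by simp) (by simp) (by simp; norm_num) (by simp) (by simp) (by simp)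

lemma comulHom_g : comulHom k (g k) = g k ⊗ₜ g k := by rw [comulHom, lift_g]
lemma comulHom_h : comulHom k (h k) = h k ⊗ₜ h k := by rw [comulHom, lift_h]
lemma comulHom_z : comulHom k (z k) = J k * (z k ⊗ₜ z k) := by rw [comulHom, lift_z]
lemma counitHom_g : counitHom k (g k) = 1 := by rw [counitHom, lift_g]
lemma counitHom_h : counitHom k (h k) = 1 := by rw [counitHom, lift_h]
lemma counitHom_z : counitHom k (z k) = 1 := by rw [counitHom, lift_z]
instance : Bialgebra k (H8 k) :=
  Bialgebra.ofAlgHom (comulHom k) (counitHom k)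
    (by
      apply algHom_ext
      · simp [comulHom_g]
      · simp [comulHom_h]
      · simp only [AlgHom.comp_apply, comulHom_z, J_mul, map_smul, map_add, map_sub, map_mul,
          Algebra.TensorProduct.map_tmul, comulHom_g, comulHom_h, AlgHom.id_apply,
          mul_smul_comm, mul_add, mul_sub,
          Algebra.TensorProduct.tmul_mul_tmul,
          TensorProduct.tmul_add, TensorProduct.add_tmul, TensorProduct.tmul_sub,
          TensorProduct.sub_tmul, TensorProduct.tmul_smul, ← TensorProduct.smul_tmul',
          AlgEquiv.coe_toAlgHom, Algebra.TensorProduct.assoc_tmul,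
          h_mul_g_assoc, h_mul_h_assoc, g_mul_g_assoc]
        module)
    (by
      apply algHom_ext
      · simp [comulHom_g, counitHom_g]
      · simp [comulHom_h, counitHom_h]
      · simp [comulHom_z, J_mul, counitHom_z, counitHom_g]
        module)
    (by
      apply algHom_ext
      · simp [comulHom_g, counitHom_g]
      · simp [comulHom_h, counitHom_h]
      · simp [comulHom_z, J_mul, counitHom_z, counitHom_h]
        module)

lemma antipode_left (x : H8 k) :
    LinearMap.mul' k (H8 k) ((antipodeLin k).rTensor (H8 k) (comulHom k x)) =
      algebraMap k (H8 k) (counitHom k x) := by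
  induction x using H8.induction with
  | hc c =>
    simp [Algebra.algebraMap_eq_smul_one, antipodeLin_one, Algebra.TensorProduct.one_def]
  | hg => simp [comulHom_g, counitHom_g, antipodeLin_g, g_mul_g]
  | hh => simp [comulHom_h, counitHom_h, antipodeLin_h, h_mul_h]
  | hz =>
    simp [comulHom_z, counitHom_z, J_mul, antipodeLin_mul, antipodeLin_g, antipodeLin_z,
      mul_assoc, z_mul_g_assoc, z_mul_h_assoc, z_mul_z, mul_add, mul_sub, h_mul_h, h_mul_g,
      g_mul_g, h_mul_g_assoc, g_mul_g_assoc]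
    module
  | hadd a b ha hb => simp [ha, hb]
  | hmul a b ha hb =>
    have h1 : ∀ (u : H8 k ⊗[k] H8 k) (c d : H8 k),
        LinearMap.mul' k (H8 k) ((antipodeLin k).rTensor (H8 k) (u * c ⊗ₜ d)) =
          antipodeLin k c *
            LinearMap.mul' k (H8 k) ((antipodeLin k).rTensor (H8 k) u) * d := by
      intro u c d
      induction u with
      | zero => simp
      | tmul p q => simp [antipodeLin_mul, mul_assoc]
      | add p q hp hq => simp only [add_mul, mul_add, map_add, hp, hq]
    have h2 : ∀ t : H8 k ⊗[k] H8 k,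
        LinearMap.mul' k (H8 k) ((antipodeLin k).rTensor (H8 k) (comulHom k a * t)) =
          counitHom k a • LinearMap.mul' k (H8 k) ((antipodeLin k).rTensor (H8 k) t) := by
      intro t
      induction t with
      | zero => simp
      | tmul p q => rw [h1, ha]; simp [Algebra.algebraMap_eq_smul_one]
      | add p q hp hq => simp only [mul_add, map_add, hp, hq, smul_add]
    rw [map_mul, h2, hb, map_mul, map_mul, Algebra.smul_def]

lemma antipode_right (x : H8 k) :
    LinearMap.mul' k (H8 k) ((antipodeLin k).lTensor (H8 k) (comulHom k x)) =
      algebraMap k (H8 k) (counitHom k x) := by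
  induction x using H8.induction with
  | hc c =>
    simp [Algebra.algebraMap_eq_smul_one, antipodeLin_one, Algebra.TensorProduct.one_def]
  | hg => simp [comulHom_g, counitHom_g, antipodeLin_g, g_mul_g]
  | hh => simp [comulHom_h, counitHom_h, antipodeLin_h, h_mul_h]
  | hz =>
    simp [comulHom_z, counitHom_z, J_mul, antipodeLin_mul, antipodeLin_h, antipodeLin_z,
      mul_assoc, z_mul_g_assoc, z_mul_h, z_mul_z, mul_add, mul_sub,
      h_mul_h, h_mul_g, g_mul_g, h_mul_g_assoc, g_mul_g_assoc]
    module
  | hadd a b ha hb => simp [ha, hb]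
  | hmul a b ha hb =>
    have h1 : ∀ (u : H8 k ⊗[k] H8 k) (c d : H8 k),
        LinearMap.mul' k (H8 k) ((antipodeLin k).lTensor (H8 k) (c ⊗ₜ d * u)) =
          c * LinearMap.mul' k (H8 k) ((antipodeLin k).lTensor (H8 k) u) *
            antipodeLin k d := by
      intro u c d
      induction u with
      | zero => simp
      | tmul p q => simp [antipodeLin_mul, mul_assoc]
      | add p q hp hq => simp only [add_mul, mul_add, map_add, hp, hq]
    have h2 : ∀ t : H8 k ⊗[k] H8 k,
        LinearMap.mul' k (H8 k) ((antipodeLin k).lTensor (H8 k) (t * comulHom k b)) =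
          counitHom k b • LinearMap.mul' k (H8 k) ((antipodeLin k).lTensor (H8 k) t) := by
      intro t
      induction t with
      | zero => simp
      | tmul p q => rw [h1, hb]; simp [Algebra.algebraMap_eq_smul_one]
      | add p q hp hq => simp only [add_mul, map_add, hp, hq, smul_add]
    rw [map_mul, h2, ha, map_mul, map_mul, Algebra.smul_def, Algebra.commutes]

instance : HopfAlgebra k (H8 k) where
  antipode := antipodeLin k
  mul_antipode_rTensor_comul := LinearMap.ext fun x => antipode_left k x
  mul_antipode_lTensor_comul := LinearMap.ext fun x => antipode_right k x

lemma comul_g : Coalgebra.comul (R := k) (g k) = g k ⊗ₜ g k := comulHom_g k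
lemma comul_h : Coalgebra.comul (R := k) (h k) = h k ⊗ₜ h k := comulHom_h k
lemma comul_z : Coalgebra.comul (R := k) (z k) = J k * (z k ⊗ₜ z k) := comulHom_z k
lemma counit_g : Coalgebra.counit (R := k) (g k) = 1 := counitHom_g k
lemma counit_h : Coalgebra.counit (R := k) (h k) = 1 := counitHom_h k
lemma counit_z : Coalgebra.counit (R := k) (z k) = 1 := counitHom_z k
lemma antipode_g : HopfAlgebra.antipode k (g k) = g k := antipodeLin_g k
lemma antipode_h : HopfAlgebra.antipode k (h k) = h k := antipodeLin_h k
lemma antipode_z : HopfAlgebra.antipode k (z k) = z k := antipodeLin_z k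

end Hopf

/-! #### The six left actions -/

section Tables

variable {k : Type*} [Field k] [CharZero k]

/-- The bilinear map with prescribed values on pairs of basis elements: row `m`, column `n` of the
table is `(m-th basis element) ⇀ (n-th basis element)`, the basis being ordered as
`1, g, h, gh, z, gz, hz, ghz`. -/
def ofTable (T : Fin 8 → Fin 8 → H8 k) : H8 k →ₗ[k] H8 k →ₗ[k] H8 k :=
  (basis k).constr k fun m => (basis k).constr k (T m)

lemma ofTable_apply (T : Fin 8 → Fin 8 → H8 k) (m n : Fin 8) :
    ofTable T (monomial k m) (monomial k n) = T m n := by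
  rw [← basis_apply, ← basis_apply, ofTable, Module.Basis.constr_basis,
    Module.Basis.constr_basis]

/-- The table with `z ⇀ g = g` and `z ⇀ z = a gz + b hz`. -/
def tableA (a b : k) : Fin 8 → Fin 8 → H8 k :=
  let g := g k
  let h := h k
  let z := z k
  ![![1, g, h, g * h, z, g * z, h * z, g * h * z],
    ![1, g, h, g * h, g * h * z, h * z, g * z, z],
    ![1, g, h, g * h, g * h * z, h * z, g * z, z],
    ![1, g, h, g * h, z, g * z, h * z, g * h * z],
    ![1, g, h, g * h, a • (g * z) + b • (h * z), a • z + b • (g * h * z),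
      a • (g * h * z) + b • z, a • (h * z) + b • (g * z)],
    ![1, g, h, g * h, a • (h * z) + b • (g * z), a • (g * h * z) + b • z,
      a • z + b • (g * h * z), a • (g * z) + b • (h * z)],
    ![1, g, h, g * h, a • (h * z) + b • (g * z), a • (g * h * z) + b • z,
      a • z + b • (g * h * z), a • (g * z) + b • (h * z)],
    ![1, g, h, g * h, a • (g * z) + b • (h * z), a • z + b • (g * h * z),
      a • (g * h * z) + b • z, a • (h * z) + b • (g * z)]]

/-- The table with `z ⇀ g = g` and `z ⇀ z = a z + b ghz`. -/
def tableB (a b : k) : Fin 8 → Fin 8 → H8 k :=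
  let g := g k
  let h := h k
  let z := z k
  ![![1, g, h, g * h, z, g * z, h * z, g * h * z],
    ![1, g, h, g * h, g * h * z, h * z, g * z, z],
    ![1, g, h, g * h, g * h * z, h * z, g * z, z],
    ![1, g, h, g * h, z, g * z, h * z, g * h * z],
    ![1, g, h, g * h, a • z + b • (g * h * z), a • (g * z) + b • (h * z),
      a • (h * z) + b • (g * z), a • (g * h * z) + b • z],
    ![1, g, h, g * h, a • (g * h * z) + b • z, a • (h * z) + b • (g * z),
      a • (g * z) + b • (h * z), a • z + b • (g * h * z)],
    ![1, g, h, g * h, a • (g * h * z) + b • z, a • (h * z) + b • (g * z),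
      a • (g * z) + b • (h * z), a • z + b • (g * h * z)],
    ![1, g, h, g * h, a • z + b • (g * h * z), a • (g * z) + b • (h * z),
      a • (h * z) + b • (g * z), a • (g * h * z) + b • z]]

/-- The table with `z ⇀ g = h` and `z ⇀ z = z³`. -/
def tableC (k : Type*) [Field k] : Fin 8 → Fin 8 → H8 k :=
  let g := g k
  let h := h k
  let z := z k
  ![![1, g, h, g * h, z, g * z, h * z, g * h * z],
    ![1, g, h, g * h, z, g * z, h * z, g * h * z],
    ![1, g, h, g * h, z, g * z, h * z, g * h * z],
    ![1, g, h, g * h, z, g * z, h * z, g * h * z],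
    ![1, h, g, g * h, z ^ 3, h * z ^ 3, g * z ^ 3, g * h * z ^ 3],
    ![1, h, g, g * h, z ^ 3, h * z ^ 3, g * z ^ 3, g * h * z ^ 3],
    ![1, h, g, g * h, z ^ 3, h * z ^ 3, g * z ^ 3, g * h * z ^ 3],
    ![1, h, g, g * h, z ^ 3, h * z ^ 3, g * z ^ 3, g * h * z ^ 3]]

/-- The table with `z ⇀ g = h` and `z ⇀ z = ghz³`. -/
def tableD (k : Type*) [Field k] : Fin 8 → Fin 8 → H8 k :=
  let g := g k
  let h := h k
  let z := z k
  ![![1, g, h, g * h, z, g * z, h * z, g * h * z],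
    ![1, g, h, g * h, z, g * z, h * z, g * h * z],
    ![1, g, h, g * h, z, g * z, h * z, g * h * z],
    ![1, g, h, g * h, z, g * z, h * z, g * h * z],
    ![1, h, g, g * h, g * h * z ^ 3, g * z ^ 3, h * z ^ 3, z ^ 3],
    ![1, h, g, g * h, g * h * z ^ 3, g * z ^ 3, h * z ^ 3, z ^ 3],
    ![1, h, g, g * h, g * h * z ^ 3, g * z ^ 3, h * z ^ 3, z ^ 3],
    ![1, h, g, g * h, g * h * z ^ 3, g * z ^ 3, h * z ^ 3, z ^ 3]]

/-- The six left actions: four with `z ⇀ g = g`, then two with `z ⇀ g = h`. Here `i` is the chosen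
square root of `-1`. -/
def leftAction (i : k) : Fin 6 → (H8 k →ₗ[k] H8 k →ₗ[k] H8 k) :=
  ![ofTable (tableA ((1 - i) / 2) ((1 + i) / 2)),
    ofTable (tableA ((1 + i) / 2) ((1 - i) / 2)),
    ofTable (tableB ((1 - i) / 2) ((1 + i) / 2)),
    ofTable (tableB ((1 + i) / 2) ((1 - i) / 2)),
    ofTable (tableC k),
    ofTable (tableD k)]

end Tables

end H8

end

/-!
The theorem splits into the existence of six matched pairs and the bound of six tabulated left
actions; the two halves meet by counting.

For the existence, let `e_χ` be the idempotents of the group algebra of `G = {1, g, h, gh}`. In the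
basis `e_χ, e_χ z` the product, coproduct and counit of `H₈`, as well as six pairs of actions, send
basis elements to sums of basis elements with coefficients `±1`, `±i`. The axioms of a matched pair
become equalities of finite lists, up to order, of pairs (exponent of `i`, index), and these are
decidable. This gives `isMatchedPairOfActions_char`, and the six pairs are distinct by
`charLeft_injective`.

For the bound, take any matched pair of actions.

* The right action is `x ↼ y = S(x₁ ⇀ y₁) x₂ y₂`, since `S ∘ (⇀)` is a convolution inverse of `⇀`
  (`eq_inducedRight`).
* For `a` in `G` the map `x ↦ x ⇀ a` is central in the convolution algebra, by the compatibility
  condition and the invertibility of `↼ a` (`left_central`). The span of `z, gz, hz, ghz` is a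
  matrix coalgebra, so a central map is constant on these four elements (`eq_of_central`). It
  follows that `G` acts trivially on itself and that `z ⇀ ·` and `· ↼ z` are involutive
  automorphisms of `G`. The equation `xy = (x₁ ⇀ y₁) (x₂ ↼ y₂)` then gives `K ⇀ a = K a (K ↼ z)`
  for `a` in `Gz` (`left_grp`), and similarly for `↼`.
* The map `z ⇀ ·` preserves the span of `Gz` (`grpProj_left_z`). Thus `⇀` is determined by `z ⇀ g`,
  `z ⇀ h`, `g ↼ z`, `h ↼ z` and `w = z ⇀ z`.
* An involutive automorphism of `G` is the identity or one of three transpositions. Of the sixteen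
  combinations for the pair `(z ⇀ ·, · ↼ z)` only the two survive in which both are the identity or
  both exchange `g` and `h` (`left_right_cases`).
* In these two cases `Δ(w) = (z₁ ⇀ z₁) ⊗ (z₂ ⇀ z₂)`, `ε(w) = 1` and `z ⇀ w = z² ⇀ z` leave four and
  two possibilities for `w`, and these are the tabulated left actions (`exists_eq_leftAction`).
-/

noncomputable section

namespace H8

/-! ### Sums of pure terms with coefficients `±1, ±i` -/

section Lists

/-- The combination `∑ i ^ c • B j` encoded by a list of pairs `(c, j)`. -/
def combo {k V J : Type*} [Field k] [AddCommGroup V] [Module k V] (i : k)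
    (B : J → V) (u : List (Fin 4 × J)) : V :=
  (u.map fun c => i ^ (c.1 : ℕ) • B c.2).sum

/-- Extension of a table of values to lists, linearly in the coefficients. -/
def linExt {J J' : Type*} (t : J → List (Fin 4 × J')) (u : List (Fin 4 × J)) :
    List (Fin 4 × J') :=
  u.flatMap fun c => (t c.2).map fun e => (c.1 + e.1, e.2)

/-- The tensor product of two lists. -/
def tens {J J' : Type*} (u : List (Fin 4 × J)) (v : List (Fin 4 × J')) :
    List (Fin 4 × (J × J')) :=
  u.flatMap fun c => v.map fun d => (c.1 + d.1, (c.2, d.2))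

/-- The family of pure tensors of two families. -/
def tmulFam (k : Type*) {V W J J' : Type*} [Field k] [AddCommGroup V] [Module k V]
    [AddCommGroup W] [Module k W] (B : J → V) (B' : J' → W) (j : J × J') : V ⊗[k] W :=
  B j.1 ⊗ₜ[k] B' j.2

variable {k V W J J' : Type*} [Field k] [AddCommGroup V] [Module k V]
  [AddCommGroup W] [Module k W] {i : k}

@[simp] lemma combo_nil (B : J → V) : combo i B [] = 0 := by simp [combo]

@[simp] lemma combo_cons (B : J → V) (c : Fin 4 × J) (u : List (Fin 4 × J)) :
    combo i B (c :: u) = i ^ (c.1 : ℕ) • B c.2 + combo i B u := by simp [combo]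

@[simp] lemma combo_append (B : J → V) (u v : List (Fin 4 × J)) :
    combo i B (u ++ v) = combo i B u + combo i B v := by simp [combo]

lemma combo_perm (B : J → V) {u v : List (Fin 4 × J)} (h : u.Perm v) :
    combo i B u = combo i B v :=
  (h.map _).sum_eq

lemma pow_fin_add (hi : i ^ 4 = 1) (a b : Fin 4) :
    i ^ ((a + b : Fin 4) : ℕ) = i ^ (a : ℕ) * i ^ (b : ℕ) := by
  rw [Fin.val_add, ← pow_eq_pow_mod _ hi, pow_add]

lemma combo_scale (hi : i ^ 4 = 1) (B : J → V) (a : Fin 4) (u : List (Fin 4 × J)) :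
    combo i B (u.map fun e => (a + e.1, e.2)) = i ^ (a : ℕ) • combo i B u := by
  induction u with
  | nil => simp
  | cons c u ih => simp [ih, pow_fin_add hi, mul_smul, smul_add]

lemma map_combo (hi : i ^ 4 = 1) {B : J → V} {B' : J' → W} (f : V →ₗ[k] W)
    {t : J → List (Fin 4 × J')} (h : ∀ j, f (B j) = combo i B' (t j)) (u : List (Fin 4 × J)) :
    f (combo i B u) = combo i B' (linExt t u) := by
  induction u with
  | nil => simp [linExt]
  | cons c u ih =>
    have : linExt t (c :: u) = ((t c.2).map fun e => (c.1 + e.1, e.2)) ++ linExt t u := rfl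
    rw [this, combo_append, combo_scale hi, ← ih, ← h]
    simp

lemma combo_tmul_combo (hi : i ^ 4 = 1) (B : J → V) (B' : J' → W) (u : List (Fin 4 × J))
    (v : List (Fin 4 × J')) :
    combo i B u ⊗ₜ[k] combo i B' v = combo i (tmulFam k B B') (tens u v) := by
  induction u with
  | nil => simp [tens]
  | cons c u ih =>
    have h1 : tens (c :: u) v = (v.map fun d => (c.1 + d.1, (c.2, d.2))) ++ tens u v := rfl
    have h2 : combo i (tmulFam k B B') (v.map fun d => (c.1 + d.1, (c.2, d.2))) =
        (i ^ (c.1 : ℕ) • B c.2) ⊗ₜ combo i B' v := by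
      clear ih h1
      induction v with
      | nil => simp
      | cons d v ih =>
        simp [ih, TensorProduct.tmul_add, tmulFam, ← TensorProduct.smul_tmul', smul_smul, mul_comm,
          pow_fin_add hi]
    rw [h1, combo_append, h2, ← ih, combo_cons, TensorProduct.add_tmul]

end Lists

/-! ### The basis of character idempotents -/

section CharBasis

variable (k : Type*) [Field k]

/-- A character of `{1, g, h, gh}` is encoded by two Booleans, `true` standing for the value `-1`
at `g` and at `h` respectively. This is the sign belonging to a Boolean. -/
def sgn (a : Bool) : k := if a then -1 else 1

/-- The idempotent `e_χ` of the group algebra of `{1, g, h, gh}` belonging to the character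
`χ = (a, b)`. -/
def idem (a b : Bool) : H8 k :=
  (1 / 4 : k) • (1 + sgn k a • g k + sgn k b • h k + (sgn k a * sgn k b) • (g k * h k))

/-- The elements `e_χ` and `e_χ z`. The first two components of the index encode `χ`, the third one
is the exponent of `z`. -/
def charElt (x : Bool × Bool × Bool) : H8 k :=
  if x.2.2 then idem k x.1 x.2.1 * z k else idem k x.1 x.2.1

lemma sgn_xor (a b : Bool) : sgn k (a ^^ b) = sgn k a * sgn k b := by
  cases a <;> cases b <;> simp [sgn]

lemma g_mul_idem (a b : Bool) : g k * idem k a b = sgn k a • idem k a b := by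
  cases a <;> simp [idem, sgn, mul_add, g_mul_g, g_mul_g_assoc] <;> module

lemma h_mul_idem (a b : Bool) : h k * idem k a b = sgn k b • idem k a b := by
  cases a <;> cases b <;> simp [idem, sgn, mul_add, h_mul_h, h_mul_g_assoc, h_mul_g] <;> module

lemma z_mul_idem (a b : Bool) : z k * idem k a b = idem k b a * z k := by
  simp [idem, mul_add, add_mul, z_mul_h, z_mul_g, z_mul_g_assoc, mul_assoc, h_mul_g_assoc]
  module

variable [CharZero k]

lemma idem_mul_of_eigen {a b c d : Bool} {x : H8 k} (hg : g k * x = sgn k c • x)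
    (hh : h k * x = sgn k d • x) :
    idem k a b * x = if a = c ∧ b = d then x else 0 := by
  have : idem k a b * x =
      ((1 / 4 : k) * ((1 + sgn k a * sgn k c) * (1 + sgn k b * sgn k d))) • x := by
    simp [idem, add_mul, mul_assoc, hg, hh]
    module
  rw [this]
  cases a <;> cases b <;> cases c <;> cases d <;> simp [sgn] <;> norm_num

lemma idem_mul_idem (a b c d : Bool) :
    idem k a b * idem k c d = if a = c ∧ b = d then idem k c d else 0 :=
  idem_mul_of_eigen k (g_mul_idem k c d) (h_mul_idem k c d)

lemma idem_mul_idem_mul (a b c d : Bool) (x : H8 k) :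
    idem k a b * (idem k c d * x) = if a = c ∧ b = d then idem k c d * x else 0 := by
  rw [← mul_assoc, idem_mul_idem]
  split_ifs <;> simp

lemma idem_mul_g (a b : Bool) : idem k a b * g k = sgn k a • idem k a b := by
  cases a <;> simp [idem, sgn, add_mul, g_mul_g, mul_assoc, h_mul_g, g_mul_g_assoc] <;> module

lemma idem_mul_h (a b : Bool) : idem k a b * h k = sgn k b • idem k a b := by
  cases a <;> cases b <;> simp [idem, sgn, add_mul, h_mul_h, mul_assoc] <;> module

lemma idem_mul_z_sq (a b : Bool) :
    idem k a b * (z k * z k) = (if a ∧ b then -1 else 1 : k) • idem k a b := by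
  rw [z_mul_z]
  simp only [mul_smul_comm, mul_sub, mul_add, mul_one, ← mul_assoc, idem_mul_g, idem_mul_h,
    smul_mul_assoc]
  cases a <;> cases b <;> simp [sgn] <;> module

lemma comul_idem (a b : Bool) :
    Coalgebra.comul (R := k) (idem k a b) =
      ∑ c : Bool, ∑ d : Bool, idem k c d ⊗ₜ[k] idem k (a ^^ c) (b ^^ d) := by
  have hgh : Coalgebra.comul (R := k) (g k * h k) = (g k * h k) ⊗ₜ[k] (g k * h k) := by
    rw [Bialgebra.comul_mul, comul_g, comul_h, Algebra.TensorProduct.tmul_mul_tmul]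
  have h1 : Coalgebra.comul (R := k) (1 : H8 k) = 1 ⊗ₜ[k] 1 := by
    rw [Bialgebra.comul_one, Algebra.TensorProduct.one_def]
  rw [idem, map_smul, map_add, map_add, map_add, map_smul, map_smul, map_smul, h1, comul_g,
    comul_h, hgh]
  simp only [idem, sgn_xor, Fintype.sum_bool, TensorProduct.tmul_smul, ← TensorProduct.smul_tmul',
    TensorProduct.tmul_add, TensorProduct.add_tmul]
  simp only [sgn, if_true, Bool.false_eq_true, if_false]
  module

lemma comul_idem_mul_z (a b : Bool) :
    Coalgebra.comul (R := k) (idem k a b * z k) =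
      ∑ c : Bool, ∑ d : Bool, (if c ∧ (b ^^ d) then -1 else 1 : k) •
        ((idem k c d * z k) ⊗ₜ[k] (idem k (a ^^ c) (b ^^ d) * z k)) := by
  rw [Bialgebra.comul_mul, comul_z, comul_idem, J_mul]
  have key : ∀ c d c' d' : Bool, idem k c d ⊗ₜ[k] idem k c' d' *
      ((1 / 2 : k) • (z k ⊗ₜ[k] z k + (g k * z k) ⊗ₜ[k] z k + z k ⊗ₜ[k] (h k * z k) -
      (g k * z k) ⊗ₜ[k] (h k * z k))) =
      (if c ∧ d' then -1 else 1 : k) • ((idem k c d * z k) ⊗ₜ[k] (idem k c' d' * z k)) := by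
    intro c d c' d'
    simp only [mul_smul_comm, mul_add, mul_sub, Algebra.TensorProduct.tmul_mul_tmul, ← mul_assoc,
      idem_mul_g, idem_mul_h, smul_mul_assoc, TensorProduct.tmul_smul, ← TensorProduct.smul_tmul']
    cases c <;> cases d' <;> simp [sgn] <;> module
  simp only [Finset.sum_mul, key]

lemma counit_idem (a b : Bool) :
    Coalgebra.counit (R := k) (idem k a b) = if a ∨ b then 0 else 1 := by
  have : Coalgebra.counit (R := k) (idem k a b) =
      (1 / 4 : k) * ((1 + sgn k a) * (1 + sgn k b)) := by
    simp [idem, counit_g, counit_h]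
    ring
  rw [this]
  cases a <;> cases b <;> simp [sgn] <;> norm_num

lemma monomial_mem_span_charElt (m : Fin 8) :
    monomial k m ∈ Submodule.span k (Set.range (charElt k)) := by
  obtain ⟨M, hM⟩ : ∃ M, M = Submodule.span k (Set.range (charElt k)) := ⟨_, rfl⟩
  have hm : ∀ x, charElt k x ∈ M := fun x => hM ▸ Submodule.subset_span ⟨x, rfl⟩
  rw [← hM]
  have hsum : ∀ (n : Bool) (s t : k), (∑ a : Bool, ∑ b : Bool,
      ((if a then s else 1) * (if b then t else 1)) • charElt k (a, b, n)) ∈ M := fun n s t =>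
    M.sum_mem fun a _ => M.sum_mem fun b _ => M.smul_mem _ (hm _)
  have e : ∀ s t : k, (∑ a : Bool, ∑ b : Bool,
      ((if a then s else 1) * (if b then t else 1)) • idem k a b) =
      (1 / 4 : k) • (((1 + s) * (1 + t)) • 1 + ((1 - s) * (1 + t)) • g k +
        ((1 + s) * (1 - t)) • h k + ((1 - s) * (1 - t)) • (g k * h k)) := by
    intro s t
    simp [idem, sgn]
    module
  have e' : ∀ s t : k, (∑ a : Bool, ∑ b : Bool,
      ((if a then s else 1) * (if b then t else 1)) • charElt k (a, b, true)) =
      (∑ a : Bool, ∑ b : Bool,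
      ((if a then s else 1) * (if b then t else 1)) • idem k a b) * z k := by
    intro s t
    simp [charElt, add_mul]
  have e'' : ∀ s t : k, (∑ a : Bool, ∑ b : Bool,
      ((if a then s else 1) * (if b then t else 1)) • charElt k (a, b, false)) =
      (∑ a : Bool, ∑ b : Bool,
      ((if a then s else 1) * (if b then t else 1)) • idem k a b) := by
    intro s t
    simp [charElt]
  have q : (4 : k)⁻¹ * (2 * 2) = 1 := by norm_num
  have f : ∀ s t : k, (1 / 4 : k) • (((1 + s) * (1 + t)) • 1 + ((1 - s) * (1 + t)) • g k +
        ((1 + s) * (1 - t)) • h k + ((1 - s) * (1 - t)) • (g k * h k)) ∈ M := fun s t => by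
    rw [← e, ← e'']
    exact hsum false s t
  have f' : ∀ s t : k, ((1 / 4 : k) • (((1 + s) * (1 + t)) • 1 + ((1 - s) * (1 + t)) • g k +
        ((1 + s) * (1 - t)) • h k + ((1 - s) * (1 - t)) • (g k * h k))) * z k ∈ M := fun s t => by
    rw [← e, ← e']
    exact hsum true s t
  fin_cases m
  · simpa [monomial, smul_smul, one_add_one_eq_two, q] using f 1 1
  · simpa [monomial, smul_smul, one_add_one_eq_two, q] using f (-1) 1
  · simpa [monomial, smul_smul, one_add_one_eq_two, q] using f 1 (-1)
  · simpa [monomial, smul_smul, one_add_one_eq_two, q] using f (-1) (-1)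
  · simpa [monomial, smul_smul, one_add_one_eq_two, q] using f' 1 1
  · simpa [monomial, smul_smul, one_add_one_eq_two, q] using f' (-1) 1
  · simpa [monomial, smul_smul, one_add_one_eq_two, q] using f' 1 (-1)
  · simpa [monomial, smul_smul, one_add_one_eq_two, q] using f' (-1) (-1)

lemma top_le_span_charElt : ⊤ ≤ Submodule.span k (Set.range (charElt k)) := by
  refine (top_le_span_monomial k).trans (Submodule.span_le.2 ?_)
  rintro _ ⟨m, rfl⟩
  exact monomial_mem_span_charElt k m

/-- The basis `e_χ, e_χ z` of `H₈`. -/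
def charBasis : Module.Basis (Bool × Bool × Bool) k (H8 k) :=
  basisOfTopLeSpanOfCardEqFinrank (charElt k) (top_le_span_charElt k)
    (by rw [Module.finrank_eq_card_basis (basis k)]; rfl)

lemma charBasis_apply (x : Bool × Bool × Bool) : charBasis k x = charElt k x := by
  simp [charBasis]

end CharBasis

/-! ### Structure constants in the character basis

In the tables a pair `(n, j)` stands for `i ^ n` times the basis element with index `j`. The values
of the counit are pairs `(n, ())`. -/

section Tables

/-- The exclusive or of two Booleans, in a form with a short evaluation. -/
def bxor (a b : Bool) : Bool := cond a (!b) b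

/-- The table of products `charElt x * charElt y`. -/
def mulTable (p : (Bool × Bool × Bool) × (Bool × Bool × Bool)) :
    List (Fin 4 × (Bool × Bool × Bool)) :=
  match p with
  | ((a, b, m), (c, d, n)) =>
    cond (bxor (cond m b a) c || bxor (cond m a b) d) []
      [(cond (m && n && a && b) 2 0, (a, b, bxor m n))]

/-- The expansion of `1`. -/
def oneTable : List (Fin 4 × (Bool × Bool × Bool)) :=
  [(0, (true, true, false)), (0, (true, false, false)), (0, (false, true, false)),
    (0, (false, false, false))]

/-- The table of coproducts `Δ (charElt x)`. -/
def comulTable (x : Bool × Bool × Bool) :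
    List (Fin 4 × ((Bool × Bool × Bool) × (Bool × Bool × Bool))) :=
  [(true, true), (true, false), (false, true), (false, false)].map fun c =>
    (cond (x.2.2 && c.1 && bxor x.2.1 c.2) 2 0,
      ((c.1, c.2, x.2.2), (bxor x.1 c.1, bxor x.2.1 c.2, x.2.2)))

/-- The table of coproducts of `charElt x ⊗ charElt y` in the tensor product coalgebra. -/
def comulTensorTable (p : (Bool × Bool × Bool) × (Bool × Bool × Bool)) :
    List (Fin 4 × (((Bool × Bool × Bool) × (Bool × Bool × Bool)) ×
      ((Bool × Bool × Bool) × (Bool × Bool × Bool)))) :=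
  linExt (fun q => [(0, ((q.1.1, q.2.1), (q.1.2, q.2.2)))])
    (tens (comulTable p.1) (comulTable p.2))

/-- The table of counits. -/
def counitTable (x : Bool × Bool × Bool) : List (Fin 4 × Unit) :=
  if x.1 || x.2.1 then [] else [(0, ())]

/-- The matched pair number `c` has `z ⇀ z = v z` with an element `v` of the group algebra whose
values at the characters are powers of `i`. These are the exponents at the characters
`(true, false)`, `(false, true)`, `(true, true)`; at the trivial character `v` is `1`. The numbering
is not the one of `leftAction`. -/
def twist : Fin 6 → Fin 4 × Fin 4 × Fin 4 :=
  ![(1, 1, 0), (3, 3, 0), (1, 3, 2), (3, 1, 2), (0, 0, 2), (2, 2, 2)]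

/-- The value of `v` at the character `(a, b)`, as an exponent of `i`. -/
def twistAt (c : Fin 6) (a b : Bool) : Fin 4 :=
  if a then if b then (twist c).2.2 else (twist c).1 else if b then (twist c).2.1 else 0

/-- Whether `z` exchanges `g` and `h` under the action. -/
def swaps (c : Fin 6) : Bool := decide (4 ≤ c.1)

/-- The table of values `charElt x ⇀ charElt y`. The group acts on `charElt y` by a character, which
is `(t, t)` in the notation of the definition, so `e_χ` annihilates `charElt y` unless
`χ = (t, t)`. The element `z` multiplies by a value of `v`, and exchanges the components of the
character if it exchanges `g` and `h`. -/
def leftTable (c : Fin 6) (p : (Bool × Bool × Bool) × (Bool × Bool × Bool)) :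
    List (Fin 4 × (Bool × Bool × Bool)) :=
  match p with
  | ((a, b, m), (a', b', n)) =>
    let t := n && !swaps c && bxor a' b'
    cond (bxor a t || bxor b t) [] <|
      cond m
        (cond (swaps c) [(cond n (twistAt c b' a') 0, (b', a', n))]
          [(cond n (twistAt c a' b') 0, (a', b', n))])
        [(0, (a', b', n))]

/-- The table of values `charElt x ↼ charElt y`. -/
def rightTable (c : Fin 6) (p : (Bool × Bool × Bool) × (Bool × Bool × Bool)) :
    List (Fin 4 × (Bool × Bool × Bool)) :=
  match p with
  | ((a, b, m), (a', b', n)) =>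
    let t := m && !swaps c && bxor a b
    cond (bxor a' t || bxor b' t) [] <|
      cond n
        (cond (swaps c) [(cond m (-twistAt c b a) 0, (b, a, m))]
          [(cond m (-twistAt c b a) 0, (a, b, m))])
        [(0, (a, b, m))]

/-- The table of values `(x₁ ⇀ y₁) ⊗ (x₂ ↼ y₂)` at `x = charElt p.1`, `y = charElt p.2`. Of the
sixteen terms of `Δ (x ⊗ y)` only the one in which `x₁` belongs to the character `(s, s)` and `y₂`
to the character `(t, t)` contributes. -/
def crossTable (c : Fin 6) (p : (Bool × Bool × Bool) × (Bool × Bool × Bool)) :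
    List (Fin 4 × ((Bool × Bool × Bool) × (Bool × Bool × Bool))) :=
  match p with
  | ((a, b, m), (a', b', n)) =>
    let s := n && !swaps c && bxor a' b'
    let t := m && !swaps c && bxor a b
    (tens (leftTable c ((s, s, m), (bxor a' t, bxor b' t, n)))
      (rightTable c ((bxor a s, bxor b s, m), (t, t, n)))).map fun e =>
        (cond (m && s && bxor b s) 2 0 + cond (n && bxor a' t && t) 2 0 + e.1, e.2)

/-- The table of a tensor product of two linear maps. -/
def mapTable {J J' K K' : Type*} (s : J → List (Fin 4 × K)) (t : J' → List (Fin 4 × K'))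
    (p : J × J') : List (Fin 4 × (K × K')) :=
  tens (s p.1) (t p.2)

/-! The following lemmas are the axioms of a matched pair of actions at basis elements. Equality of
combinations is obtained from lists that agree up to order, no terms having to be collected. -/

set_option synthInstance.maxSize 1000
set_option synthInstance.maxHeartbeats 200000

lemma check_one_left : ∀ (c : Fin 6) (a : Bool × Bool × Bool),
    List.Perm (linExt (fun j => leftTable c (j, a)) oneTable) [(0, a)] := by
  decide +kernel

lemma check_mul_left : ∀ (c : Fin 6) (x y a : Bool × Bool × Bool),
    List.Perm (linExt (fun j => leftTable c (j, a)) (mulTable (x, y)))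
      (linExt (fun j => leftTable c (x, j)) (leftTable c (y, a))) := by
  decide +kernel

lemma check_counit_left : ∀ (c : Fin 6) (x a : Bool × Bool × Bool),
    List.Perm (linExt (counitTable) (leftTable c (x, a)))
      (linExt (fun _ => counitTable a) (counitTable x)) := by
  decide +kernel

lemma check_comul_left : ∀ (c : Fin 6) (x a : Bool × Bool × Bool),
    List.Perm (linExt comulTable (leftTable c (x, a)))
      (linExt (mapTable (leftTable c) (leftTable c)) (comulTensorTable (x, a))) := by
  decide +kernel

lemma check_one_right : ∀ (c : Fin 6) (a : Bool × Bool × Bool),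
    List.Perm (linExt (fun j => rightTable c (a, j)) oneTable) [(0, a)] := by
  decide +kernel

lemma check_mul_right : ∀ (c : Fin 6) (x a b : Bool × Bool × Bool),
    List.Perm (linExt (fun j => rightTable c (x, j)) (mulTable (a, b)))
      (linExt (fun j => rightTable c (j, b)) (rightTable c (x, a))) := by
  decide +kernel

lemma check_counit_right : ∀ (c : Fin 6) (x a : Bool × Bool × Bool),
    List.Perm (linExt (counitTable) (rightTable c (x, a)))
      (linExt (fun _ => counitTable a) (counitTable x)) := by
  decide +kernel

lemma check_comul_right : ∀ (c : Fin 6) (x a : Bool × Bool × Bool),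
    List.Perm (linExt comulTable (rightTable c (x, a)))
      (linExt (mapTable (rightTable c) (rightTable c)) (comulTensorTable (x, a))) := by
  decide +kernel

lemma check_cross : ∀ (c : Fin 6) (x a : Bool × Bool × Bool),
    List.Perm (linExt (mapTable (leftTable c) (rightTable c)) (comulTensorTable (x, a)))
      (crossTable c (x, a)) := by
  decide +kernel

lemma check_left_mul : ∀ (c : Fin 6) (x a b : Bool × Bool × Bool),
    List.Perm (linExt (fun j => leftTable c (x, j)) (mulTable (a, b)))
      (linExt mulTable (linExt (mapTable (fun j => [(0, j)]) fun j => leftTable c (j, b))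
        (crossTable c (x, a)))) := by
  decide +kernel

lemma check_left_one : ∀ (c : Fin 6) (x : Bool × Bool × Bool),
    List.Perm (linExt (fun j => leftTable c (x, j)) oneTable)
      (linExt (fun _ => oneTable) (counitTable x)) := by
  decide +kernel

lemma check_right_mul : ∀ (c : Fin 6) (x y a : Bool × Bool × Bool),
    List.Perm (linExt (fun j => rightTable c (j, a)) (mulTable (x, y)))
      (linExt mulTable (linExt (mapTable (fun j => rightTable c (x, j)) fun j => [(0, j)])
        (crossTable c (y, a)))) := by
  decide +kernel

lemma check_right_one : ∀ (c : Fin 6) (a : Bool × Bool × Bool),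
    List.Perm (linExt (fun j => rightTable c (j, a)) oneTable)
      (linExt (fun _ => oneTable) (counitTable a)) := by
  decide +kernel

lemma check_compat : ∀ (c : Fin 6) (x a : Bool × Bool × Bool),
    List.Perm (linExt (mapTable (rightTable c) (leftTable c)) (comulTensorTable (x, a)))
      (linExt (fun q => [(0, (q.2, q.1))]) (crossTable c (x, a))) := by
  decide +kernel

lemma check_mul_eq : ∀ (c : Fin 6) (x y : Bool × Bool × Bool),
    List.Perm (mulTable (x, y)) (linExt mulTable (crossTable c (x, y))) := by
  decide +kernel

end Tables

/-! ### The six matched pairs -/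

section Existence

variable {k : Type*} [Field k] {i : k}

lemma pow_four (hi : i ^ 2 = -1) : i ^ 4 = 1 := by
  rw [show (4 : ℕ) = 2 * 2 from rfl, pow_mul, hi]; norm_num

lemma map_tmulFam (hi : i ^ 2 = -1) {V W V' W' J K J' K' : Type*} [AddCommGroup V] [Module k V]
    [AddCommGroup W] [Module k W] [AddCommGroup V'] [Module k V'] [AddCommGroup W'] [Module k W']
    {B : J → V} {C : K → W} {B' : J' → V'} {C' : K' → W'} {f : V →ₗ[k] W} {f' : V' →ₗ[k] W'}
    {s : J → List (Fin 4 × K)} {s' : J' → List (Fin 4 × K')} (h : ∀ j, f (B j) = combo i C (s j))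
    (h' : ∀ j, f' (B' j) = combo i C' (s' j)) (p : J × J') :
    TensorProduct.map f f' (tmulFam k B B' p) = combo i (tmulFam k C C') (mapTable s s' p) := by
  rw [tmulFam, TensorProduct.map_tmul, h, h', combo_tmul_combo (pow_four hi), mapTable]

variable [CharZero k]

lemma mul_charElt (hi : i ^ 2 = -1) (x y : Bool × Bool × Bool) :
    charElt k x * charElt k y = combo i (charElt k) (mulTable (x, y)) := by
  obtain ⟨a, b, m⟩ := x
  obtain ⟨c, d, n⟩ := y
  cases m <;> cases n
  · simp only [charElt, mulTable, Bool.false_eq_true, if_false, idem_mul_idem]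
    by_cases h : a = c ∧ b = d
    · obtain ⟨rfl, rfl⟩ := h; cases a <;> cases b <;> simp [charElt, bxor]
    · rw [if_neg h]; revert h; cases a <;> cases b <;> cases c <;> cases d <;> simp [bxor]
  · simp only [charElt, mulTable, Bool.false_eq_true, if_false, if_true, ← mul_assoc, idem_mul_idem]
    by_cases h : a = c ∧ b = d
    · obtain ⟨rfl, rfl⟩ := h; cases a <;> cases b <;> simp [charElt, bxor]
    · rw [if_neg h]; revert h; cases a <;> cases b <;> cases c <;> cases d <;> simp [bxor]
  · simp only [charElt, mulTable, Bool.false_eq_true, if_false, if_true, mul_assoc, z_mul_idem,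
      idem_mul_idem_mul]
    by_cases h : a = d ∧ b = c
    · obtain ⟨rfl, rfl⟩ := h; cases a <;> cases b <;> simp [charElt, bxor]
    · rw [if_neg h]; revert h; cases a <;> cases b <;> cases c <;> cases d <;> simp [bxor]
  · have : idem k a b * z k * (idem k c d * z k) = idem k a b * (idem k d c * (z k * z k)) := by
      rw [mul_assoc, ← mul_assoc (z k), z_mul_idem, mul_assoc]
    simp only [charElt, mulTable, if_true, this, idem_mul_idem_mul]
    by_cases h : a = d ∧ b = c
    · obtain ⟨rfl, rfl⟩ := h
      rw [if_pos ⟨rfl, rfl⟩, idem_mul_z_sq]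
      cases a <;> cases b <;> simp [charElt, bxor, hi]
    · rw [if_neg h]; revert h; cases a <;> cases b <;> cases c <;> cases d <;> simp [bxor]

lemma comul_charElt (hi : i ^ 2 = -1) (x : Bool × Bool × Bool) :
    Coalgebra.comul (R := k) (charElt k x) =
      combo i (tmulFam k (charElt k) (charElt k)) (comulTable x) := by
  obtain ⟨a, b, m⟩ := x
  cases m
  · cases a <;> cases b <;> simp [charElt, comul_idem, comulTable, bxor, tmulFam, add_assoc]
  · simp only [charElt, if_true, comul_idem_mul_z]
    cases a <;> cases b <;> simp [charElt, comulTable, bxor, tmulFam, add_assoc, hi]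

lemma counit_charElt (x : Bool × Bool × Bool) :
    Coalgebra.counit (R := k) (charElt k x) =
      combo i (fun _ : Unit => (1 : k)) (counitTable x) := by
  obtain ⟨a, b, m⟩ := x
  cases a <;> cases b <;> cases m <;>
    simp [charElt, counitTable, counit_idem, counit_z]

lemma one_eq_combo : (1 : H8 k) = combo i (charElt k) oneTable := by
  simp [oneTable, charElt, idem, sgn]
  module

lemma comul_tmul_charElt (hi : i ^ 2 = -1) (x y : Bool × Bool × Bool) :
    Coalgebra.comul (R := k) (charElt k x ⊗ₜ[k] charElt k y) =
      combo i (tmulFam k (tmulFam k (charElt k) (charElt k)) (tmulFam k (charElt k) (charElt k)))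
        (comulTensorTable (x, y)) := by
  rw [TensorProduct.comul_tmul, comul_charElt hi, comul_charElt hi,
    combo_tmul_combo (pow_four hi)]
  have h : ∀ q, (TensorProduct.AlgebraTensorModule.tensorTensorTensorComm k k k k (H8 k) (H8 k)
      (H8 k) (H8 k)).toLinearMap
        (tmulFam k (tmulFam k (charElt k) (charElt k)) (tmulFam k (charElt k) (charElt k)) q) =
      combo i (tmulFam k (tmulFam k (charElt k) (charElt k)) (tmulFam k (charElt k) (charElt k)))
        [(0, ((q.1.1, q.2.1), (q.1.2, q.2.2)))] := by
    rintro ⟨⟨p, q⟩, r, s⟩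
    simp [tmulFam]
  exact map_combo (pow_four hi) _ h _

/-- The bilinear map with a given table of values on the basis `charElt`. -/
def ofCharTable (i : k) (t : (Bool × Bool × Bool) × (Bool × Bool × Bool) →
    List (Fin 4 × (Bool × Bool × Bool))) : H8 k →ₗ[k] H8 k →ₗ[k] H8 k :=
  (charBasis k).constr k fun x => (charBasis k).constr k fun y => combo i (charElt k) (t (x, y))

lemma ofCharTable_apply (t : (Bool × Bool × Bool) × (Bool × Bool × Bool) →
    List (Fin 4 × (Bool × Bool × Bool))) (x y : Bool × Bool × Bool) :
    ofCharTable i t (charElt k x) (charElt k y) = combo i (charElt k) (t (x, y)) := by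
  rw [← charBasis_apply, ← charBasis_apply, ofCharTable, Module.Basis.constr_basis,
    Module.Basis.constr_basis]

lemma induction_charElt {P : H8 k → Prop} (x : H8 k) (hB : ∀ j, P (charElt k j))
    (hadd : ∀ a b, P a → P b → P (a + b)) (hsmul : ∀ (c : k) a, P a → P (c • a)) : P x := by
  have hx : x ∈ Submodule.span k (Set.range (charElt k)) := top_le_span_charElt k trivial
  induction hx using Submodule.span_induction with
  | mem x hx => obtain ⟨j, rfl⟩ := hx; exact hB j
  | zero => simpa using hsmul 0 _ (hB (true, true, true))
  | add a b _ _ ha hb => exact hadd a b ha hb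
  | smul c a _ ha => exact hsmul c a ha

/-- The left action of the matched pair number `c`. -/
def charLeft (i : k) (c : Fin 6) : H8 k →ₗ[k] H8 k →ₗ[k] H8 k := ofCharTable i (leftTable c)

/-- The right action of the matched pair number `c`. -/
def charRight (i : k) (c : Fin 6) : H8 k →ₗ[k] H8 k →ₗ[k] H8 k := ofCharTable i (rightTable c)

lemma lift_ofCharTable (t : (Bool × Bool × Bool) × (Bool × Bool × Bool) →
    List (Fin 4 × (Bool × Bool × Bool))) (p : (Bool × Bool × Bool) × (Bool × Bool × Bool)) :
    TensorProduct.lift (ofCharTable i t) (tmulFam k (charElt k) (charElt k) p) =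
      combo i (charElt k) (t p) := by
  rw [tmulFam, TensorProduct.lift.tmul, ofCharTable_apply]

lemma mul'_charElt (hi : i ^ 2 = -1) (p : (Bool × Bool × Bool) × (Bool × Bool × Bool)) :
    LinearMap.mul' k (H8 k) (tmulFam k (charElt k) (charElt k) p) =
      combo i (charElt k) (mulTable p) := by
  rw [tmulFam, LinearMap.mul'_apply, mul_charElt hi]

lemma map_comul_charElt (hi : i ^ 2 = -1) (c : Fin 6) (x a : Bool × Bool × Bool) :
    TensorProduct.map (TensorProduct.lift (charLeft i c)) (TensorProduct.lift (charRight i c))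
        (Coalgebra.comul (R := k) (charElt k x ⊗ₜ[k] charElt k a)) =
      combo i (tmulFam k (charElt k) (charElt k)) (crossTable c (x, a)) := by
  rw [charLeft, charRight, comul_tmul_charElt hi, map_combo (pow_four hi) _
    (map_tmulFam hi (lift_ofCharTable (leftTable c)) (lift_ofCharTable (rightTable c))),
    combo_perm _ (check_cross c x a)]

lemma isMatchedPair_char (hi : i ^ 2 = -1) (c : Fin 6) :
    IsMatchedPair k (charLeft i c) (charRight i c) := by
  have h4 := pow_four hi
  have Ll : ∀ x y, charLeft i c (charElt k x) (charElt k y) =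
      combo i (charElt k) (leftTable c (x, y)) := ofCharTable_apply _
  have Lr : ∀ x y, charRight i c (charElt k x) (charElt k y) =
      combo i (charElt k) (rightTable c (x, y)) := ofCharTable_apply _
  have Tl : ∀ p, TensorProduct.lift (charLeft i c) (tmulFam k (charElt k) (charElt k) p) =
      combo i (charElt k) (leftTable c p) := lift_ofCharTable _
  have Tr : ∀ p, TensorProduct.lift (charRight i c) (tmulFam k (charElt k) (charElt k) p) =
      combo i (charElt k) (rightTable c p) := lift_ofCharTable _
  -- the values of an action on combinations in one argument
  have Ll' : ∀ (u) (y), charLeft i c (combo i (charElt k) u) (charElt k y) =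
      combo i (charElt k) (linExt (fun j => leftTable c (j, y)) u) := fun u y =>
    map_combo h4 ((charLeft i c).flip (charElt k y)) (fun j => Ll j y) u
  have Lr' : ∀ (u) (y), charRight i c (combo i (charElt k) u) (charElt k y) =
      combo i (charElt k) (linExt (fun j => rightTable c (j, y)) u) := fun u y =>
    map_combo h4 ((charRight i c).flip (charElt k y)) (fun j => Lr j y) u
  have Tid : ∀ j, (LinearMap.id : H8 k →ₗ[k] H8 k) (charElt k j) =
      combo i (charElt k) [(0, j)] := fun j => by simp
  have hcross := map_comul_charElt hi c
  constructor
  · have base : ∀ a : Bool × Bool × Bool, charLeft i c 1 (charElt k a) = charElt k a := by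
      intro a
      rw [one_eq_combo (i := i), Ll', combo_perm _ (check_one_left c a)]
      simp
    intro a
    induction a using induction_charElt
    on_goal 1 => exact base _
    all_goals simp only [map_add, map_smul, *]
  · have base : ∀ x y a : Bool × Bool × Bool,
        charLeft i c ((charElt k x) * (charElt k y)) (charElt k a) =
        charLeft i c (charElt k x) (charLeft i c (charElt k y) (charElt k a)) := by
      intro x y a
      rw [mul_charElt hi, Ll', Ll, map_combo h4 _ (Ll x), combo_perm _ (check_mul_left c x y a)]
    intro x y a
    induction x using induction_charElt
    on_goal 1 => induction y using induction_charElt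
    on_goal 1 => induction a using induction_charElt
    on_goal 1 => exact base _ _ _
    all_goals simp only [map_add, map_smul, LinearMap.add_apply, LinearMap.smul_apply, add_mul,
      mul_add, smul_mul_assoc, mul_smul_comm, *]
  · have base : ∀ x a : Bool × Bool × Bool,
        Coalgebra.counit (R := k) (charLeft i c (charElt k x) (charElt k a)) =
        Coalgebra.counit (R := k) (charElt k x) * Coalgebra.counit (R := k) (charElt k a) := by
      intro x a
      have h : ∀ _ : Unit, LinearMap.mulRight k (Coalgebra.counit (R := k) (charElt k a)) 1 =
          combo i (fun _ : Unit => (1 : k)) (counitTable a) := by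
        intro
        simp [counit_charElt (i := i)]
      rw [Ll, map_combo h4 _ (counit_charElt (k := k) (i := i)),
        combo_perm _ (check_counit_left c x a), ← map_combo h4 _ h, ← counit_charElt]
      simp
    intro x a
    induction x using induction_charElt
    on_goal 1 => induction a using induction_charElt
    on_goal 1 => exact base _ _
    all_goals simp only [map_add, map_smul, LinearMap.add_apply, LinearMap.smul_apply, add_mul,
      mul_add, smul_eq_mul, mul_assoc, mul_left_comm, *]
  · have base : ∀ x a : Bool × Bool × Bool,
        Coalgebra.comul (R := k) (charLeft i c (charElt k x) (charElt k a)) =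
        TensorProduct.map (TensorProduct.lift (charLeft i c)) (TensorProduct.lift (charLeft i c))
          (Coalgebra.comul (R := k) (charElt k x ⊗ₜ[k] charElt k a)) := by
      intro x a
      rw [Ll, map_combo h4 _ (comul_charElt hi), comul_tmul_charElt hi,
        map_combo h4 _ (map_tmulFam hi Tl Tl), combo_perm _ (check_comul_left c x a)]
    intro x a
    induction x using induction_charElt
    on_goal 1 => induction a using induction_charElt
    on_goal 1 => exact base _ _
    all_goals simp only [map_add, map_smul, LinearMap.add_apply, LinearMap.smul_apply,
      TensorProduct.add_tmul, TensorProduct.tmul_add, TensorProduct.tmul_smul,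
      ← TensorProduct.smul_tmul', *]
  · have base : ∀ a : Bool × Bool × Bool, charRight i c (charElt k a) 1 = charElt k a := by
      intro a
      rw [one_eq_combo (i := i), map_combo h4 _ (Lr a), combo_perm _ (check_one_right c a)]
      simp
    intro a
    induction a using induction_charElt
    on_goal 1 => exact base _
    all_goals simp only [map_add, map_smul, LinearMap.add_apply, LinearMap.smul_apply, *]
  · have base : ∀ x a b : Bool × Bool × Bool,
        charRight i c (charElt k x) ((charElt k a) * (charElt k b)) =
        charRight i c (charRight i c (charElt k x) (charElt k a)) (charElt k b) := by
      intro x a b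
      rw [mul_charElt hi, Lr, Lr', map_combo h4 _ (Lr x), combo_perm _ (check_mul_right c x a b)]
    intro x a b
    induction x using induction_charElt
    on_goal 1 => induction a using induction_charElt
    on_goal 1 => induction b using induction_charElt
    on_goal 1 => exact base _ _ _
    all_goals simp only [map_add, map_smul, LinearMap.add_apply, LinearMap.smul_apply, add_mul,
      mul_add, smul_mul_assoc, mul_smul_comm, *]
  · have base : ∀ x a : Bool × Bool × Bool,
        Coalgebra.counit (R := k) (charRight i c (charElt k x) (charElt k a)) =
        Coalgebra.counit (R := k) (charElt k x) * Coalgebra.counit (R := k) (charElt k a) := by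
      intro x a
      have h : ∀ _ : Unit, LinearMap.mulRight k (Coalgebra.counit (R := k) (charElt k a)) 1 =
          combo i (fun _ : Unit => (1 : k)) (counitTable a) := by
        intro
        simp [counit_charElt (i := i)]
      rw [Lr, map_combo h4 _ (counit_charElt (k := k) (i := i)),
        combo_perm _ (check_counit_right c x a), ← map_combo h4 _ h, ← counit_charElt]
      simp
    intro x a
    induction x using induction_charElt
    on_goal 1 => induction a using induction_charElt
    on_goal 1 => exact base _ _
    all_goals simp only [map_add, map_smul, LinearMap.add_apply, LinearMap.smul_apply, add_mul,
      mul_add, smul_eq_mul, mul_assoc, mul_left_comm, *]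
  · have base : ∀ x a : Bool × Bool × Bool,
        Coalgebra.comul (R := k) (charRight i c (charElt k x) (charElt k a)) =
        TensorProduct.map (TensorProduct.lift (charRight i c)) (TensorProduct.lift (charRight i c))
          (Coalgebra.comul (R := k) (charElt k x ⊗ₜ[k] charElt k a)) := by
      intro x a
      rw [Lr, map_combo h4 _ (comul_charElt hi), comul_tmul_charElt hi,
        map_combo h4 _ (map_tmulFam hi Tr Tr), combo_perm _ (check_comul_right c x a)]
    intro x a
    induction x using induction_charElt
    on_goal 1 => induction a using induction_charElt
    on_goal 1 => exact base _ _
    all_goals simp only [map_add, map_smul, LinearMap.add_apply, LinearMap.smul_apply,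
      TensorProduct.add_tmul, TensorProduct.tmul_add, TensorProduct.tmul_smul,
      ← TensorProduct.smul_tmul', *]
  · have base : ∀ x a b : Bool × Bool × Bool,
        charLeft i c (charElt k x) ((charElt k a) * (charElt k b)) =
        LinearMap.mul' k (H8 k) (TensorProduct.map (TensorProduct.lift (charLeft i c))
          ((charLeft i c).flip (charElt k b) ∘ₗ TensorProduct.lift (charRight i c))
          (Coalgebra.comul (R := k) (charElt k x ⊗ₜ[k] charElt k a))) := by
      intro x a b
      rw [← LinearMap.id_comp (TensorProduct.lift (charLeft i c)), TensorProduct.map_comp,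
        LinearMap.comp_apply, hcross, map_combo h4 _ (map_tmulFam hi Tid fun j => Ll j b),
        map_combo h4 _ (mul'_charElt hi), mul_charElt hi, map_combo h4 _ (Ll x),
        combo_perm _ (check_left_mul c x a b)]
    intro x a b
    induction x using induction_charElt
    on_goal 1 => induction a using induction_charElt
    on_goal 1 => induction b using induction_charElt
    on_goal 1 => exact base _ _ _
    all_goals simp only [map_add, map_smul, LinearMap.add_apply, LinearMap.smul_apply, add_mul,
      mul_add, smul_mul_assoc, mul_smul_comm, TensorProduct.add_tmul, TensorProduct.tmul_add,
      TensorProduct.tmul_smul, ← TensorProduct.smul_tmul', LinearMap.add_comp, LinearMap.smul_comp,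
      TensorProduct.map_add_right, TensorProduct.map_smul_right, *]
  · have base : ∀ x : Bool × Bool × Bool, charLeft i c (charElt k x) 1 =
        Coalgebra.counit (R := k) (charElt k x) • (1 : H8 k) := by
      intro x
      have h : ∀ _ : Unit, LinearMap.toSpanSingleton k (H8 k) (combo i (charElt k) oneTable) 1 =
          combo i (charElt k) oneTable := by
        intro
        simp
      rw [one_eq_combo (i := i), map_combo h4 _ (Ll x), combo_perm _ (check_left_one c x),
        counit_charElt (i := i), ← map_combo h4 _ h, LinearMap.toSpanSingleton_apply]
    intro x
    induction x using induction_charElt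
    on_goal 1 => exact base _
    all_goals simp only [map_add, map_smul, LinearMap.add_apply, LinearMap.smul_apply, add_smul,
      smul_assoc, *]
  · have base : ∀ x y a : Bool × Bool × Bool,
        charRight i c ((charElt k x) * (charElt k y)) (charElt k a) =
        LinearMap.mul' k (H8 k) (TensorProduct.map
          (charRight i c (charElt k x) ∘ₗ TensorProduct.lift (charLeft i c))
          (TensorProduct.lift (charRight i c))
          (Coalgebra.comul (R := k) (charElt k y ⊗ₜ[k] charElt k a))) := by
      intro x y a
      rw [← LinearMap.id_comp (TensorProduct.lift (charRight i c)), TensorProduct.map_comp,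
        LinearMap.comp_apply, hcross, map_combo h4 _ (map_tmulFam hi (Lr x) Tid),
        map_combo h4 _ (mul'_charElt hi), mul_charElt hi, Lr',
        combo_perm _ (check_right_mul c x y a)]
    intro x y a
    induction x using induction_charElt
    on_goal 1 => induction y using induction_charElt
    on_goal 1 => induction a using induction_charElt
    on_goal 1 => exact base _ _ _
    all_goals simp only [map_add, map_smul, LinearMap.add_apply, LinearMap.smul_apply, add_mul,
      mul_add, smul_mul_assoc, mul_smul_comm, TensorProduct.add_tmul, TensorProduct.tmul_add,
      TensorProduct.tmul_smul, ← TensorProduct.smul_tmul', LinearMap.add_comp, LinearMap.smul_comp,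
      TensorProduct.map_add_left, TensorProduct.map_smul_left, *]
  · have base : ∀ x : Bool × Bool × Bool, charRight i c 1 (charElt k x) =
        Coalgebra.counit (R := k) (charElt k x) • (1 : H8 k) := by
      intro x
      have h : ∀ _ : Unit, LinearMap.toSpanSingleton k (H8 k) (combo i (charElt k) oneTable) 1 =
          combo i (charElt k) oneTable := by
        intro
        simp
      rw [one_eq_combo (i := i), Lr', combo_perm _ (check_right_one c x),
        counit_charElt (i := i), ← map_combo h4 _ h, LinearMap.toSpanSingleton_apply]
    intro x
    induction x using induction_charElt
    on_goal 1 => exact base _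
    all_goals simp only [map_add, map_smul, add_smul,
      smul_assoc, *]
  · have base : ∀ x a : Bool × Bool × Bool,
        TensorProduct.map (TensorProduct.lift (charLeft i c)) (TensorProduct.lift (charRight i c))
          (Coalgebra.comul (R := k) (charElt k x ⊗ₜ[k] charElt k a)) =
        TensorProduct.comm k (H8 k) (H8 k)
          (TensorProduct.map (TensorProduct.lift (charRight i c))
            (TensorProduct.lift (charLeft i c))
            (Coalgebra.comul (R := k) (charElt k x ⊗ₜ[k] charElt k a))) := by
      intro x a
      have h : ∀ j, (TensorProduct.comm k (H8 k) (H8 k)).toLinearMap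
          (tmulFam k (charElt k) (charElt k) j) =
            combo i (tmulFam k (charElt k) (charElt k)) [(0, (j.2, j.1))] := by
        intro j
        simp [tmulFam]
      rw [hcross, comul_tmul_charElt hi, map_combo h4 _ (map_tmulFam hi Tr Tl),
        combo_perm _ (check_compat c x a), ← map_combo h4 _ h]
      exact (TensorProduct.comm_comm ..).symm
    intro x a
    induction x using induction_charElt
    on_goal 1 => induction a using induction_charElt
    on_goal 1 => exact base _ _
    all_goals simp only [map_add, map_smul,
      TensorProduct.add_tmul, TensorProduct.tmul_add, TensorProduct.tmul_smul,
      ← TensorProduct.smul_tmul', *]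

lemma isMatchedPairOfActions_char (hi : i ^ 2 = -1) (c : Fin 6) :
    IsMatchedPairOfActions k (charLeft i c) (charRight i c) := by
  have h4 := pow_four hi
  refine ⟨isMatchedPair_char hi c, fun x y => ?_⟩
  have base : ∀ x y : Bool × Bool × Bool, charElt k x * charElt k y =
      LinearMap.mul' k (H8 k) (TensorProduct.map (TensorProduct.lift (charLeft i c))
        (TensorProduct.lift (charRight i c))
        (Coalgebra.comul (R := k) (charElt k x ⊗ₜ[k] charElt k y))) := by
    intro x y
    rw [map_comul_charElt hi, mul_charElt hi, map_combo h4 _ (mul'_charElt hi),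
      combo_perm _ (check_mul_eq c x y)]
  induction x using induction_charElt
  on_goal 1 => induction y using induction_charElt
  on_goal 1 => exact base _ _
  all_goals simp only [map_add, map_smul, add_mul, mul_add, smul_mul_assoc, mul_smul_comm,
    TensorProduct.add_tmul, TensorProduct.tmul_add, TensorProduct.tmul_smul,
    ← TensorProduct.smul_tmul', *]

end Existence

end H8

/-! ### The right action is determined by the left action -/

/-- In the convolution algebra of linear maps `H ⊗ H → H` the left action has the inverse
`S ∘ (⇀)`, so the equation `(⇀) * (↼) = (multiplication)` determines `↼`. -/
lemma IsMatchedPairOfActions.eq_inducedRight {k H : Type*} [Field k] [Ring H] [HopfAlgebra k H]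
    {l r : H →ₗ[k] H →ₗ[k] H} (hp : IsMatchedPairOfActions k l r) : r = inducedRight k l := by
  let A : WithConv (H ⊗[k] H →ₗ[k] H) := WithConv.toConv (TensorProduct.lift l)
  let B : WithConv (H ⊗[k] H →ₗ[k] H) := WithConv.toConv (TensorProduct.lift r)
  let M : WithConv (H ⊗[k] H →ₗ[k] H) := WithConv.toConv (LinearMap.mul' k H)
  let S : WithConv (H ⊗[k] H →ₗ[k] H) :=
    WithConv.toConv (HopfAlgebra.antipode k ∘ₗ TensorProduct.lift l)
  have hAB : A * B = M := by
    rw [LinearMap.convMul_def]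
    congr 1
    refine TensorProduct.ext' fun x y => ?_
    simp only [A, B, LinearMap.comp_apply, LinearMap.mul'_apply]
    exact (hp.mul_eq x y).symm
  have hSA : S * A = 1 := by
    rw [LinearMap.convMul_def, LinearMap.convOne_def]
    congr 1
    refine TensorProduct.ext' fun x y => ?_
    have h1 : TensorProduct.map S.ofConv A.ofConv =
        (HopfAlgebra.antipode k (A := H)).rTensor H ∘ₗ
          TensorProduct.map (TensorProduct.lift l) (TensorProduct.lift l) := by
      rw [LinearMap.rTensor, ← TensorProduct.map_comp, LinearMap.id_comp]
    rw [h1, LinearMap.comp_apply, LinearMap.comp_apply, LinearMap.comp_apply, ← hp.comul_left,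
      HopfAlgebra.mul_antipode_rTensor_comul_apply, hp.counit_left]
    simp [mul_comm]
  have hB : B = S * M := by rw [← hAB, ← mul_assoc, hSA, one_mul]
  have hB' : TensorProduct.lift r = LinearMap.mul' k H ∘ₗ
      TensorProduct.map (HopfAlgebra.antipode k ∘ₗ TensorProduct.lift l) (LinearMap.mul' k H) ∘ₗ
        Coalgebra.comul (R := k) (A := H ⊗[k] H) := congrArg WithConv.ofConv hB
  rw [inducedRight, ← hB']
  ext x y
  simp

namespace H8

section Distinct

variable {k : Type*} [Field k] [CharZero k] {i : k}

/-- The six left actions are distinguished by the values of `v` at the characters `(true, false)`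
and `(false, true)`, and by whether `z` exchanges the two. -/
lemma charLeft_injective (hi : i ^ 2 = -1) : Function.Injective (charLeft i) := by
  have hi0 : i ≠ 0 := by rintro rfl; norm_num at hi
  have hi3 : i ^ 3 = -i := by rw [pow_succ, hi]; ring
  have hne : i ≠ -i := fun h => hi0 (self_eq_neg.1 h)
  have key : ∀ (c : Fin 6) (x y j : Bool × Bool × Bool),
      (charBasis k).coord j (charLeft i c (charElt k x) (charElt k y)) =
        ((leftTable c (x, y)).map fun e => if e.2 = j then i ^ (e.1 : ℕ) else 0).sum := by
    intro c x y j
    rw [charLeft, ofCharTable_apply]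
    induction leftTable c (x, y) with
    | nil => simp
    | cons e u ih =>
      rw [combo_cons, map_add, ih, map_smul, ← charBasis_apply]
      simp [Finsupp.single_apply]
  intro c c' h
  have h1 := key c (true, true, true) (true, false, true) (true, false, true)
  have h2 := key c (true, true, true) (false, true, true) (false, true, true)
  have h3 := key c (false, false, true) (true, false, true) (false, true, true)
  rw [h, key] at h1 h2 h3
  fin_cases c <;> fin_cases c' <;> first | rfl | skip
  all_goals exfalso
  all_goals simp [leftTable, bxor, swaps, twistAt, twist, hi, hi3, hi0] at h1 h2 h3
  all_goals first
    | exact hne h1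
    | exact hne h1.symm
    | exact hne h2
    | exact hne h2.symm
    | norm_num at h3

end Distinct

/-! ### Coordinates and grouplike elements -/

section Coordinates

variable {k : Type*} [Field k] [CharZero k]

/-- The coordinate of an element of `H₈` in the monomial basis. -/
def coord (m : Fin 8) : H8 k →ₗ[k] k := (basis k).coord m

lemma coord_monomial (m n : Fin 8) : coord m (monomial k n) = if n = m then 1 else 0 := by
  rw [← basis_apply, coord, Module.Basis.coord_apply, Module.Basis.repr_self,
    Finsupp.single_apply]

@[simp] lemma coord_one (m : Fin 8) : coord m (1 : H8 k) = if (0 : Fin 8) = m then 1 else 0 :=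
  coord_monomial m 0

@[simp] lemma coord_g (m : Fin 8) : coord m (g k) = if (1 : Fin 8) = m then 1 else 0 :=
  coord_monomial m 1

@[simp] lemma coord_h (m : Fin 8) : coord m (h k) = if (2 : Fin 8) = m then 1 else 0 :=
  coord_monomial m 2

@[simp] lemma coord_gh (m : Fin 8) : coord m (g k * h k) = if (3 : Fin 8) = m then 1 else 0 :=
  coord_monomial m 3

@[simp] lemma coord_z (m : Fin 8) : coord m (z k) = if (4 : Fin 8) = m then 1 else 0 :=
  coord_monomial m 4

@[simp] lemma coord_gz (m : Fin 8) : coord m (g k * z k) = if (5 : Fin 8) = m then 1 else 0 :=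
  coord_monomial m 5

@[simp] lemma coord_hz (m : Fin 8) : coord m (h k * z k) = if (6 : Fin 8) = m then 1 else 0 :=
  coord_monomial m 6

@[simp] lemma coord_ghz (m : Fin 8) :
    coord m (g k * (h k * z k)) = if (7 : Fin 8) = m then 1 else 0 := by
  rw [← mul_assoc]
  exact coord_monomial m 7

lemma eq_sum_coord (x : H8 k) :
    x = coord 0 x • 1 + coord 1 x • g k + coord 2 x • h k + coord 3 x • (g k * h k) +
      coord 4 x • z k + coord 5 x • (g k * z k) + coord 6 x • (h k * z k) +
      coord 7 x • (g k * (h k * z k)) := by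
  conv_lhs => rw [← (basis k).sum_repr x]
  simp [Fin.sum_univ_eight, basis_apply, monomial, coord, mul_assoc]

/-- The coordinate of an element of `H₈ ⊗ H₈`. -/
def coord₂ (m n : Fin 8) : H8 k ⊗[k] H8 k →ₗ[k] k :=
  LinearMap.mul' k k ∘ₗ TensorProduct.map (coord m) (coord n)

@[simp] lemma coord₂_tmul (m n : Fin 8) (x y : H8 k) :
    coord₂ m n (x ⊗ₜ y) = coord m x * coord n y := by simp [coord₂]

lemma comul_gh : Coalgebra.comul (R := k) (g k * h k) = (g k * h k) ⊗ₜ (g k * h k) := by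
  simp [Bialgebra.comul_mul, comul_g, comul_h]

lemma comul_z' : Coalgebra.comul (R := k) (z k) =
    (1 / 2 : k) • (z k ⊗ₜ z k + (g k * z k) ⊗ₜ z k + z k ⊗ₜ (h k * z k) -
      (g k * z k) ⊗ₜ (h k * z k)) := by
  rw [comul_z, J_mul]

lemma comul_gz : Coalgebra.comul (R := k) (g k * z k) =
    (1 / 2 : k) • ((g k * z k) ⊗ₜ (g k * z k) + z k ⊗ₜ (g k * z k) +
      (g k * z k) ⊗ₜ (g k * (h k * z k)) - z k ⊗ₜ (g k * (h k * z k))) := by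
  rw [Bialgebra.comul_mul, comul_z', comul_g]
  simp [mul_add, mul_sub, g_mul_g_assoc]

lemma comul_hz : Coalgebra.comul (R := k) (h k * z k) =
    (1 / 2 : k) • ((h k * z k) ⊗ₜ (h k * z k) + (g k * (h k * z k)) ⊗ₜ (h k * z k) +
      (h k * z k) ⊗ₜ z k - (g k * (h k * z k)) ⊗ₜ z k) := by
  rw [Bialgebra.comul_mul, comul_z', comul_h]
  simp [mul_add, mul_sub, h_mul_g_assoc, h_mul_h_assoc]

lemma comul_ghz : Coalgebra.comul (R := k) (g k * (h k * z k)) =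
    (1 / 2 : k) • ((g k * (h k * z k)) ⊗ₜ (g k * (h k * z k)) +
      (h k * z k) ⊗ₜ (g k * (h k * z k)) + (g k * (h k * z k)) ⊗ₜ (g k * z k) -
      (h k * z k) ⊗ₜ (g k * z k)) := by
  rw [Bialgebra.comul_mul, comul_hz, comul_g]
  simp [mul_add, mul_sub, g_mul_g_assoc]

/-- `x` is one of the grouplike elements `1, g, h, gh`. -/
def IsGrp (x : H8 k) : Prop := x = 1 ∨ x = g k ∨ x = h k ∨ x = g k * h k

/-- The grouplike elements of `H₈` are `1, g, h, gh`. Comparing coordinates in `Δ x = x ⊗ x`, a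
nonzero coordinate at an element of the group is `1` and the only nonzero one. Otherwise `x` lies in
the span of `z, gz, hz, ghz`, a matrix coalgebra, which has no grouplike elements. -/
lemma isGrp_of_comul {x : H8 k} (h1 : Coalgebra.comul (R := k) x = x ⊗ₜ x)
    (h2 : Coalgebra.counit (R := k) x = 1) : IsGrp x := by
  obtain ⟨a, b, c, d, p, q, s, t, hx⟩ : ∃ a b c d p q s t : k, x = a • 1 + b • g k + c • h k +
    d • (g k * h k) + p • z k + q • (g k * z k) + s • (h k * z k) + t • (g k * (h k * z k)) :=
    ⟨_, _, _, _, _, _, _, _, eq_sum_coord x⟩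
  have h3 : a + b + c + d + p + q + s + t = 1 := by
    rw [hx] at h2
    simpa [counit_g, counit_h, counit_z] using h2
  have key : ∀ m n, coord₂ m n (Coalgebra.comul (R := k) x) = coord m x * coord n x := by
    intro m n
    rw [h1, coord₂_tmul]
  rw [hx] at key
  simp only [map_add, map_smul, Bialgebra.comul_one, comul_g, comul_h, comul_gh, comul_z', comul_gz,
    comul_hz, comul_ghz, Algebra.TensorProduct.one_def, map_sub, coord₂_tmul, coord_one, coord_g,
    coord_h, coord_gh, coord_z, coord_gz, coord_hz, coord_ghz, smul_eq_mul] at key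
  have e00 := key 0 0
  have e11 := key 1 1
  have e22 := key 2 2
  have e33 := key 3 3
  have e01 := key 0 1
  have e02 := key 0 2
  have e03 := key 0 3
  have e12 := key 1 2
  have e13 := key 1 3
  have e23 := key 2 3
  have e04 := key 0 4
  have e05 := key 0 5
  have e06 := key 0 6
  have e07 := key 0 7
  have e14 := key 1 4
  have e15 := key 1 5
  have e16 := key 1 6
  have e17 := key 1 7
  have e24 := key 2 4
  have e25 := key 2 5
  have e26 := key 2 6
  have e27 := key 2 7
  have e34 := key 3 4
  have e35 := key 3 5
  have e36 := key 3 6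
  have e37 := key 3 7
  have e44 := key 4 4
  have e45 := key 4 5
  have e54 := key 5 4
  have e46 := key 4 6
  have e64 := key 6 4
  have e56 := key 5 6
  have e67 := key 6 7
  clear key
  simp at e00 e11 e22 e33 e01 e02 e03 e12 e13 e23 e04 e05 e06 e07 e14 e15 e16 e17
  simp at e24 e25 e26 e27 e34 e35 e36 e37
  have one_of : ∀ {u : k}, u ≠ 0 → u = u * u → u = 1 := fun hu h =>
    (mul_left_cancel₀ hu (by rw [mul_one]; exact h)).symm
  by_cases ha : a = 0
  · by_cases hb : b = 0
    · by_cases hc : c = 0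
      · by_cases hd : d = 0
        · exfalso
          simp at e44 e45 e54 e46 e64 e56 e67
          grind
        · refine Or.inr (Or.inr (Or.inr ?_))
          rw [hx, one_of hd e33]
          simp [ha, hb, hc, e34.resolve_left hd, e35.resolve_left hd, e36.resolve_left hd,
            e37.resolve_left hd]
      · refine Or.inr (Or.inr (Or.inl ?_))
        rw [hx, one_of hc e22]
        simp [ha, hb, e23.resolve_left hc, e24.resolve_left hc, e25.resolve_left hc,
          e26.resolve_left hc, e27.resolve_left hc]
    · refine Or.inr (Or.inl ?_)
      rw [hx, one_of hb e11]
      simp [ha, e12.resolve_left hb, e13.resolve_left hb, e14.resolve_left hb,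
        e15.resolve_left hb, e16.resolve_left hb, e17.resolve_left hb]
  · refine Or.inl ?_
    rw [hx, one_of ha e00]
    simp [e01.resolve_left ha, e02.resolve_left ha, e03.resolve_left ha,
      e04.resolve_left ha, e05.resolve_left ha, e06.resolve_left ha, e07.resolve_left ha]

end Coordinates

end H8

/-! ### Matched pairs and grouplike elements -/

section Linear

variable {k H V W : Type*} [Field k] [AddCommGroup H] [Module k H]
  [AddCommGroup V] [Module k V] [AddCommGroup W] [Module k W]

lemma map_comm_apply {p : H →ₗ[k] V} {q : H →ₗ[k] W} (t : H ⊗[k] H) :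
    TensorProduct.map p q (TensorProduct.comm k H H t) =
      TensorProduct.comm k W V (TensorProduct.map q p t) := by
  induction t with
  | zero => simp
  | tmul u v => simp
  | add s t hs ht => simp only [map_add, hs, ht]

lemma lift_comp_mk_flip (l : H →ₗ[k] H →ₗ[k] V) (a : H) :
    TensorProduct.lift l ∘ₗ (TensorProduct.mk k H H).flip a = l.flip a := by
  ext; simp

lemma lift_comp_mk (l : H →ₗ[k] H →ₗ[k] V) (x : H) :
    TensorProduct.lift l ∘ₗ TensorProduct.mk k H H x = l x := by
  ext; simp

end Linear

section Coalgebra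

variable {k H V W : Type*} [Field k] [AddCommGroup H] [Module k H] [Coalgebra k H]
  [AddCommGroup V] [Module k V] [AddCommGroup W] [Module k W]

lemma map_comul_tmul_of_comul_eq (p : H ⊗[k] H →ₗ[k] V) (q : H ⊗[k] H →ₗ[k] W) (x : H) {a : H}
    (ha : Coalgebra.comul (R := k) a = a ⊗ₜ a) :
    TensorProduct.map p q (Coalgebra.comul (R := k) (x ⊗ₜ[k] a)) =
      TensorProduct.map (p ∘ₗ (TensorProduct.mk k H H).flip a)
        (q ∘ₗ (TensorProduct.mk k H H).flip a) (Coalgebra.comul (R := k) x) := by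
  rw [TensorProduct.comul_tmul, ha]
  induction Coalgebra.comul (R := k) x with
  | zero => simp
  | tmul u v => simp
  | add s t hs ht => rw [TensorProduct.add_tmul, map_add, map_add, hs, ht, map_add]

lemma map_comul_tmul_of_comul_eq' (p : H ⊗[k] H →ₗ[k] V) (q : H ⊗[k] H →ₗ[k] W) {x : H}
    (hx : Coalgebra.comul (R := k) x = x ⊗ₜ x) (a : H) :
    TensorProduct.map p q (Coalgebra.comul (R := k) (x ⊗ₜ[k] a)) =
      TensorProduct.map (p ∘ₗ TensorProduct.mk k H H x)
        (q ∘ₗ TensorProduct.mk k H H x) (Coalgebra.comul (R := k) a) := by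
  rw [TensorProduct.comul_tmul, hx]
  induction Coalgebra.comul (R := k) a with
  | zero => simp
  | tmul u v => simp
  | add s t hs ht => rw [TensorProduct.tmul_add, map_add, map_add, hs, ht, map_add]

end Coalgebra

section

variable {k H : Type*} [Field k] [Ring H] [HopfAlgebra k H] {l r : H →ₗ[k] H →ₗ[k] H}

/-- For a grouplike element `a` with `a² = 1` the map `x ↦ x ⇀ a` is a central element of the
convolution algebra of linear maps on `H`: cancel the invertible map `x ↦ x ↼ a` in the
compatibility condition. -/
lemma IsMatchedPair.left_central (hp : IsMatchedPair k l r) {a : H}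
    (ha : Coalgebra.comul (R := k) a = a ⊗ₜ a) (ha2 : a * a = 1) (x : H) :
    TensorProduct.map (l.flip a) LinearMap.id (Coalgebra.comul (R := k) x) =
      TensorProduct.map (l.flip a) LinearMap.id
        (TensorProduct.comm k H H (Coalgebra.comul (R := k) x)) := by
  have hr : r.flip a ∘ₗ r.flip a = LinearMap.id := by
    ext x
    simp [← hp.mul_right, ha2, hp.one_right]
  have h := hp.compat x a
  rw [map_comul_tmul_of_comul_eq _ _ _ ha, map_comul_tmul_of_comul_eq _ _ _ ha, lift_comp_mk_flip,
    lift_comp_mk_flip, ← map_comm_apply] at h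
  have h' := congrArg (TensorProduct.map LinearMap.id (r.flip a)) h
  rwa [TensorProduct.map_map, TensorProduct.map_map, hr, LinearMap.id_comp] at h'

/-- The mirror image of `IsMatchedPair.left_central`. -/
lemma IsMatchedPair.right_central (hp : IsMatchedPair k l r) {x : H}
    (hx : Coalgebra.comul (R := k) x = x ⊗ₜ x) (hx2 : x * x = 1) (a : H) :
    TensorProduct.map (r x) LinearMap.id (Coalgebra.comul (R := k) a) =
      TensorProduct.map (r x) LinearMap.id
        (TensorProduct.comm k H H (Coalgebra.comul (R := k) a)) := by
  have hl : l x ∘ₗ l x = LinearMap.id := by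
    ext a
    simp [← hp.mul_left, hx2, hp.one_left]
  have h := hp.compat x a
  rw [map_comul_tmul_of_comul_eq' _ _ hx, map_comul_tmul_of_comul_eq' _ _ hx, lift_comp_mk,
    lift_comp_mk] at h
  have h' := congrArg (fun t => TensorProduct.comm k H H (TensorProduct.map (l x) LinearMap.id t)) h
  simpa only [← map_comm_apply, TensorProduct.comm_comm, TensorProduct.map_map, hl,
    LinearMap.id_comp, eq_comm] using h'

end

namespace H8

variable {k : Type*} [Field k]

lemma IsGrp.mul_self {x : H8 k} (hx : IsGrp x) : x * x = 1 := by
  rcases hx with rfl | rfl | rfl | rfl <;>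
    simp [g_mul_g, h_mul_h, h_mul_g_assoc, mul_assoc]

lemma IsGrp.mul_self_mul {x : H8 k} (hx : IsGrp x) (y : H8 k) : x * (x * y) = y := by
  rw [← mul_assoc, hx.mul_self, one_mul]

/-- `x` is one of `z, gz, hz, ghz`. -/
def IsGrpZ (x : H8 k) : Prop :=
  x = z k ∨ x = g k * z k ∨ x = h k * z k ∨ x = g k * (h k * z k)

lemma IsGrp.one : IsGrp (1 : H8 k) := Or.inl rfl
lemma IsGrp.g : IsGrp (g k) := Or.inr (Or.inl rfl)
lemma IsGrp.h : IsGrp (h k) := Or.inr (Or.inr (Or.inl rfl))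
lemma IsGrp.gh : IsGrp (H8.g k * H8.h k) := Or.inr (Or.inr (Or.inr rfl))
lemma IsGrpZ.z : IsGrpZ (z k) := Or.inl rfl
lemma IsGrpZ.gz : IsGrpZ (g k * H8.z k) := Or.inr (Or.inl rfl)
lemma IsGrpZ.hz : IsGrpZ (h k * H8.z k) := Or.inr (Or.inr (Or.inl rfl))
lemma IsGrpZ.ghz : IsGrpZ (g k * (h k * H8.z k)) := Or.inr (Or.inr (Or.inr rfl))

variable [CharZero k]

lemma IsGrp.comul {x : H8 k} (hx : IsGrp x) : Coalgebra.comul (R := k) x = x ⊗ₜ x := by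
  rcases hx with rfl | rfl | rfl | rfl
  exacts [Bialgebra.comul_one, comul_g k, comul_h k, comul_gh]

lemma IsGrp.counit {x : H8 k} (hx : IsGrp x) : Coalgebra.counit (R := k) x = 1 := by
  rcases hx with rfl | rfl | rfl | rfl <;> simp [counit_g, counit_h]

lemma z_pow_four (x : H8 k) : z k * (z k * (z k * (z k * x))) = x := by
  have h2 : ∀ y, z k * (z k * y) = (1 / 2 : k) • (y + g k * y + h k * y - g k * (h k * y)) := by
    intro y
    rw [← mul_assoc, z_mul_z]
    simp [add_mul, sub_mul, mul_assoc]
  rw [h2, h2]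
  simp [mul_add, mul_sub, g_mul_g_assoc, h_mul_h_assoc, h_mul_g_assoc]
  module

/-- A central element of the convolution algebra is constant on `z, gz, hz, ghz`, as these span a
matrix coalgebra. -/
lemma eq_of_central {V : Type*} [AddCommGroup V] [Module k V] (f : H8 k →ₗ[k] V)
    (hf : ∀ x, IsGrpZ x → TensorProduct.map f LinearMap.id (Coalgebra.comul (R := k) x) =
      TensorProduct.map f LinearMap.id
        (TensorProduct.comm k (H8 k) (H8 k) (Coalgebra.comul (R := k) x)))
    {x : H8 k} (hx : IsGrpZ x) : f x = f (z k) := by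
  have e : ∀ n x, IsGrpZ x → TensorProduct.rid k V (TensorProduct.map f (coord n)
      (Coalgebra.comul (R := k) x)) = TensorProduct.rid k V (TensorProduct.map f (coord n)
        (TensorProduct.comm k (H8 k) (H8 k) (Coalgebra.comul (R := k) x))) := by
    intro n x hx
    have := congrArg (fun t => TensorProduct.rid k V
      (TensorProduct.map LinearMap.id (coord n) t)) (hf x hx)
    simpa only [TensorProduct.map_map, LinearMap.id_comp, LinearMap.comp_id] using this
  have e1 := e 6 _ IsGrpZ.z
  have e2 := e 5 _ IsGrpZ.z
  have e3 := e 4 _ IsGrpZ.hz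
  simp [comul_z'] at e1 e2
  rw [comul_hz] at e3
  simp at e3
  have h1 : f (z k) = f (g k * z k) := sub_eq_zero.1 e1
  have h2 : f (z k) = f (h k * z k) := sub_eq_zero.1 (by simpa using e2.symm)
  have h3 : f (h k * z k) = f (g k * (h k * z k)) := sub_eq_zero.1 (by simpa using e3)
  rcases hx with rfl | rfl | rfl | rfl
  exacts [rfl, h1.symm, h2.symm, (h2.trans h3).symm]

/-! ### The group `{1, g, h, gh}` under the actions -/

section

variable {k : Type*} [Field k]

lemma IsGrp.mul_z {x : H8 k} (hx : IsGrp x) : IsGrpZ (x * z k) := by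
  rcases hx with rfl | rfl | rfl | rfl <;> simp [IsGrpZ, mul_assoc]

lemma IsGrp.z_mul {x : H8 k} (hx : IsGrp x) : IsGrpZ (z k * x) := by
  rcases hx with rfl | rfl | rfl | rfl <;>
    simp [IsGrpZ, z_mul_g, z_mul_h, z_mul_g_assoc, h_mul_g_assoc]

lemma IsGrp.mul_isGrpZ {x y : H8 k} (hx : IsGrp x) (hy : IsGrpZ y) : IsGrpZ (x * y) := by
  rcases hx with rfl | rfl | rfl | rfl <;> rcases hy with rfl | rfl | rfl | rfl <;>
    simp [IsGrpZ, mul_assoc, g_mul_g_assoc, h_mul_g_assoc, h_mul_h_assoc]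

lemma IsGrpZ.mul_isGrp {x y : H8 k} (hx : IsGrpZ x) (hy : IsGrp y) : IsGrpZ (x * y) := by
  rcases hx with rfl | rfl | rfl | rfl <;> rcases hy with rfl | rfl | rfl | rfl <;>
    simp [IsGrpZ, mul_assoc, z_mul_g, z_mul_h, z_mul_g_assoc, g_mul_g_assoc, h_mul_g_assoc,
      h_mul_h_assoc]

end

section MatchedPair

variable {k : Type*} [Field k] [CharZero k] {l r : H8 k →ₗ[k] H8 k →ₗ[k] H8 k}

lemma left_zpow_four (hp : IsMatchedPair k l r) (a : H8 k) :
    l (z k) (l (z k) (l (z k) (l (z k) a))) = a := by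
  rw [← hp.mul_left, ← hp.mul_left, ← hp.mul_left, ← mul_one (z k * z k * z k * z k), mul_assoc,
    mul_assoc, mul_assoc, z_pow_four, hp.one_left]

lemma right_zpow_four (hp : IsMatchedPair k l r) (x : H8 k) :
    r (r (r (r x (z k)) (z k)) (z k)) (z k) = x := by
  rw [← hp.mul_right, ← hp.mul_right, ← hp.mul_right, ← mul_one (z k * (z k * (z k * z k))),
    mul_assoc, mul_assoc, mul_assoc, z_pow_four, hp.one_right]

lemma left_z_injective (hp : IsMatchedPair k l r) : Function.Injective (l (z k)) := fun a b h => by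
  rw [← left_zpow_four hp a, h, left_zpow_four hp b]

lemma right_z_injective (hp : IsMatchedPair k l r) {x y : H8 k} (h : r x (z k) = r y (z k)) :
    x = y := by
  rw [← right_zpow_four hp x, h, right_zpow_four hp y]

lemma left_eq_left_z (hp : IsMatchedPair k l r) {a x : H8 k} (ha : IsGrp a) (hx : IsGrpZ x) :
    l x a = l (z k) a :=
  eq_of_central (l.flip a) (fun y _ => hp.left_central ha.comul ha.mul_self y) hx

lemma right_eq_right_z (hp : IsMatchedPair k l r) {a x : H8 k} (hx : IsGrp x) (ha : IsGrpZ a) :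
    r x a = r x (z k) :=
  eq_of_central (r x) (fun y _ => hp.right_central hx.comul hx.mul_self y) ha

/-- `z ⇀ a` is again grouplike, because `a` has the same image under `z`, `gz` and `hz`. -/
lemma isGrp_left (hp : IsMatchedPair k l r) {a : H8 k} (ha : IsGrp a) : IsGrp (l (z k) a) := by
  refine isGrp_of_comul ?_ ?_
  · rw [hp.comul_left, map_comul_tmul_of_comul_eq _ _ _ ha.comul, lift_comp_mk_flip, comul_z']
    simp [left_eq_left_z hp ha IsGrpZ.gz, left_eq_left_z hp ha IsGrpZ.hz]
    module
  · rw [hp.counit_left, ha.counit, counit_z, mul_one]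

lemma isGrp_right (hp : IsMatchedPair k l r) {x : H8 k} (hx : IsGrp x) : IsGrp (r x (z k)) := by
  refine isGrp_of_comul ?_ ?_
  · rw [hp.comul_right, map_comul_tmul_of_comul_eq' _ _ hx.comul, lift_comp_mk, comul_z']
    simp [right_eq_right_z hp hx IsGrpZ.gz, right_eq_right_z hp hx IsGrpZ.hz]
    module
  · rw [hp.counit_right, hx.counit, counit_z, mul_one]

/-- The group acts trivially on itself: `z` permutes it, and `xz` acts on it like `z`. -/
lemma left_grp_grp (hp : IsMatchedPair k l r) {x a : H8 k} (hx : IsGrp x) (ha : IsGrp a) :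
    l x a = a := by
  have h1 : ∀ {b}, IsGrp b → l x (l (z k) b) = l (z k) b := fun {b} hb => by
    rw [← hp.mul_left, left_eq_left_z hp hb hx.mul_z]
  have h2 := h1 (isGrp_left hp (isGrp_left hp (isGrp_left hp ha)))
  rwa [left_zpow_four hp] at h2

lemma right_grp_grp (hp : IsMatchedPair k l r) {x a : H8 k} (hx : IsGrp x) (ha : IsGrp a) :
    r x a = x := by
  have h1 : ∀ {y}, IsGrp y → r (r y (z k)) a = r y (z k) := fun {y} hy => by
    rw [← hp.mul_right, right_eq_right_z hp hy ha.z_mul]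
  have h2 := h1 (isGrp_right hp (isGrp_right hp (isGrp_right hp hx)))
  rwa [right_zpow_four hp] at h2

lemma left_z_left_z (hp : IsMatchedPair k l r) {a : H8 k} (ha : IsGrp a) :
    l (z k) (l (z k) a) = a := by
  rw [← hp.mul_left, z_mul_z]
  simp only [map_smul, map_add, map_sub, LinearMap.smul_apply, LinearMap.add_apply,
    LinearMap.sub_apply, left_grp_grp hp IsGrp.one ha, left_grp_grp hp IsGrp.g ha,
    left_grp_grp hp IsGrp.h ha, left_grp_grp hp IsGrp.gh ha]
  module

lemma right_z_right_z (hp : IsMatchedPair k l r) {x : H8 k} (hx : IsGrp x) :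
    r (r x (z k)) (z k) = x := by
  rw [← hp.mul_right, z_mul_z]
  simp only [map_smul, map_add, map_sub, right_grp_grp hp hx IsGrp.one,
    right_grp_grp hp hx IsGrp.g, right_grp_grp hp hx IsGrp.h, right_grp_grp hp hx IsGrp.gh]
  module

/-- The equation `xa = (x₁ ⇀ a₁) (x₂ ↼ a₂)` for `x` in the group, on which `↼ a₂` acts like
`↼ z`. -/
lemma left_grp_mul (hp : IsMatchedPairOfActions k l r) {x a : H8 k} (hx : IsGrp x)
    (ha : IsGrpZ a) : l x a * r x (z k) = x * a := by
  have hr : ∀ {b}, IsGrpZ b → r x b = r x (z k) := right_eq_right_z hp.toIsMatchedPair hx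
  rw [hp.mul_eq x a, map_comul_tmul_of_comul_eq' _ _ hx.comul, lift_comp_mk, lift_comp_mk]
  rcases ha with rfl | rfl | rfl | rfl
  · simp [comul_z', hr IsGrpZ.hz]
    module
  · rw [comul_gz]
    simp [hr IsGrpZ.gz, hr IsGrpZ.ghz]
    module
  · rw [comul_hz]
    simp [hr IsGrpZ.hz]
    module
  · rw [comul_ghz]
    simp [hr IsGrpZ.gz, hr IsGrpZ.ghz]
    module

/-- The group acts on `z, gz, hz, ghz` from the left by multiplications. -/
lemma left_grp (hp : IsMatchedPairOfActions k l r) {x a : H8 k} (hx : IsGrp x)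
    (ha : IsGrpZ a) : l x a = x * (a * r x (z k)) := by
  rw [← mul_assoc, ← left_grp_mul hp hx ha, mul_assoc,
    (isGrp_right hp.toIsMatchedPair hx).mul_self, mul_one]

lemma mul_right_grp (hp : IsMatchedPairOfActions k l r) {x a : H8 k} (hx : IsGrpZ x)
    (ha : IsGrp a) : l (z k) a * r x a = x * a := by
  have hl : ∀ {y}, IsGrpZ y → l y a = l (z k) a := left_eq_left_z hp.toIsMatchedPair ha
  rw [hp.mul_eq x a, map_comul_tmul_of_comul_eq _ _ _ ha.comul, lift_comp_mk_flip,
    lift_comp_mk_flip]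
  rcases hx with rfl | rfl | rfl | rfl
  · simp [comul_z', hl IsGrpZ.gz]
    module
  · rw [comul_gz]
    simp [hl IsGrpZ.gz]
    module
  · rw [comul_hz]
    simp [hl IsGrpZ.hz, hl IsGrpZ.ghz]
    module
  · rw [comul_ghz]
    simp [hl IsGrpZ.hz, hl IsGrpZ.ghz]
    module

/-- The group acts on `z, gz, hz, ghz` from the right by multiplications. -/
lemma right_grp (hp : IsMatchedPairOfActions k l r) {x a : H8 k} (hx : IsGrpZ x)
    (ha : IsGrp a) : r x a = l (z k) a * (x * a) := by
  rw [← mul_right_grp hp hx ha, (isGrp_left hp.toIsMatchedPair ha).mul_self_mul]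

end MatchedPair

/-! ### Automorphisms induced by `z` -/

section

variable {k V W : Type*} [Field k] [CharZero k] [AddCommGroup V] [Module k V] [AddCommGroup W]
  [Module k W]

lemma map_comul_z_tmul (l : H8 k →ₗ[k] H8 k →ₗ[k] V) (r : H8 k →ₗ[k] H8 k →ₗ[k] W) (a : H8 k) :
    TensorProduct.map (TensorProduct.lift l) (TensorProduct.lift r)
        (Coalgebra.comul (R := k) (z k ⊗ₜ[k] a)) =
      (1 / 2 : k) • (TensorProduct.map (l (z k)) (r (z k)) (Coalgebra.comul (R := k) a) +
        TensorProduct.map (l (g k * z k)) (r (z k)) (Coalgebra.comul (R := k) a) +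
        TensorProduct.map (l (z k)) (r (h k * z k)) (Coalgebra.comul (R := k) a) -
        TensorProduct.map (l (g k * z k)) (r (h k * z k)) (Coalgebra.comul (R := k) a)) := by
  rw [TensorProduct.comul_tmul, comul_z']
  induction Coalgebra.comul (R := k) a with
  | zero => simp
  | tmul u v =>
    simp only [← TensorProduct.smul_tmul', TensorProduct.add_tmul, TensorProduct.sub_tmul, map_smul,
      map_add, map_sub, TensorProduct.AlgebraTensorModule.tensorTensorTensorComm_tmul,
      TensorProduct.map_tmul, TensorProduct.lift.tmul]
  | add s t hs ht =>
    simp only [TensorProduct.tmul_add, map_add, hs, ht]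
    module

lemma map_comul_tmul_z (l : H8 k →ₗ[k] H8 k →ₗ[k] V) (r : H8 k →ₗ[k] H8 k →ₗ[k] W) (x : H8 k) :
    TensorProduct.map (TensorProduct.lift l) (TensorProduct.lift r)
        (Coalgebra.comul (R := k) (x ⊗ₜ[k] z k)) =
      (1 / 2 : k) • (TensorProduct.map (l.flip (z k)) (r.flip (z k)) (Coalgebra.comul (R := k) x) +
        TensorProduct.map (l.flip (g k * z k)) (r.flip (z k)) (Coalgebra.comul (R := k) x) +
        TensorProduct.map (l.flip (z k)) (r.flip (h k * z k)) (Coalgebra.comul (R := k) x) -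
        TensorProduct.map (l.flip (g k * z k)) (r.flip (h k * z k))
          (Coalgebra.comul (R := k) x)) := by
  rw [TensorProduct.comul_tmul, comul_z']
  induction Coalgebra.comul (R := k) x with
  | zero => simp
  | tmul u v =>
    simp only [TensorProduct.tmul_smul, TensorProduct.tmul_add, TensorProduct.tmul_sub, map_smul,
      map_add, map_sub, TensorProduct.AlgebraTensorModule.tensorTensorTensorComm_tmul,
      TensorProduct.map_tmul, TensorProduct.lift.tmul, LinearMap.flip_apply]
  | add s t hs ht =>
    simp only [TensorProduct.add_tmul, map_add, hs, ht]
    module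

/-- The span of `z, gz, hz, ghz` is a subcoalgebra. -/
lemma map_comul_congr {p p' : H8 k →ₗ[k] V} {q q' : H8 k →ₗ[k] W}
    (hp : ∀ a, IsGrpZ a → p a = p' a) (hq : ∀ a, IsGrpZ a → q a = q' a) {a : H8 k}
    (ha : IsGrpZ a) : TensorProduct.map p q (Coalgebra.comul (R := k) a) =
      TensorProduct.map p' q' (Coalgebra.comul (R := k) a) := by
  rcases ha with rfl | rfl | rfl | rfl
  · rw [comul_z']
    simp [hp _ IsGrpZ.z, hq _ IsGrpZ.z, hp _ IsGrpZ.gz, hq _ IsGrpZ.hz]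
  · rw [comul_gz]
    simp [hp _ IsGrpZ.z, hp _ IsGrpZ.gz, hq _ IsGrpZ.gz, hq _ IsGrpZ.ghz]
  · rw [comul_hz]
    simp [hp _ IsGrpZ.hz, hp _ IsGrpZ.ghz, hq _ IsGrpZ.z, hq _ IsGrpZ.hz]
  · rw [comul_ghz]
    simp [hp _ IsGrpZ.hz, hp _ IsGrpZ.ghz, hq _ IsGrpZ.gz, hq _ IsGrpZ.ghz]

end

section MatchedPair

variable {k : Type*} [Field k] [CharZero k] {l r : H8 k →ₗ[k] H8 k →ₗ[k] H8 k}

lemma isGrpZ_left (hp : IsMatchedPairOfActions k l r) {x a : H8 k} (hx : IsGrp x)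
    (ha : IsGrpZ a) : IsGrpZ (l x a) := by
  rw [left_grp hp hx ha]
  exact hx.mul_isGrpZ (ha.mul_isGrp (isGrp_right hp.toIsMatchedPair hx))

lemma isGrpZ_right (hp : IsMatchedPairOfActions k l r) {x a : H8 k} (hx : IsGrpZ x)
    (ha : IsGrp a) : IsGrpZ (r x a) := by
  rw [right_grp hp hx ha]
  exact (isGrp_left hp.toIsMatchedPair ha).mul_isGrpZ (hx.mul_isGrp ha)

lemma left_z_mul (hp : IsMatchedPair k l r) {a : H8 k} (ha : IsGrp a) (b : H8 k) :
    l (z k) (a * b) = l (z k) a * l (r (z k) a) b := by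
  rw [hp.left_mul, map_comul_tmul_of_comul_eq _ _ _ ha.comul, lift_comp_mk_flip, comul_z']
  simp [left_eq_left_z hp ha IsGrpZ.gz]
  module

lemma mul_right_z (hp : IsMatchedPair k l r) {y : H8 k} (hy : IsGrp y) (x : H8 k) :
    r (x * y) (z k) = r x (l y (z k)) * r y (z k) := by
  rw [hp.right_mul, map_comul_tmul_of_comul_eq' _ _ hy.comul, lift_comp_mk, comul_z']
  simp [right_eq_right_z hp hy IsGrpZ.hz]
  module

lemma left_z_gh (hp : IsMatchedPairOfActions k l r) :
    l (z k) (g k * h k) = l (z k) (g k) * l (z k) (h k) := by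
  rw [left_z_mul hp.toIsMatchedPair IsGrp.g,
    left_eq_left_z hp.toIsMatchedPair IsGrp.h (isGrpZ_right hp IsGrpZ.z IsGrp.g)]

lemma gh_right_z (hp : IsMatchedPairOfActions k l r) :
    r (g k * h k) (z k) = r (g k) (z k) * r (h k) (z k) := by
  rw [mul_right_z hp.toIsMatchedPair IsGrp.h,
    right_eq_right_z hp.toIsMatchedPair IsGrp.g (isGrpZ_left hp IsGrp.h IsGrpZ.z)]

lemma left_z_one (hp : IsMatchedPair k l r) : l (z k) 1 = 1 := by
  rw [hp.left_one, counit_z, one_smul]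

lemma one_right_z (hp : IsMatchedPair k l r) : r 1 (z k) = 1 := by
  rw [hp.right_one, counit_z, one_smul]

lemma ne_of_coord (m : Fin 8) {x y : H8 k} (h : coord m x ≠ coord m y) : x ≠ y :=
  fun e => h (by rw [e])

/-- An involutive endomorphism of `{1, g, h, gh}` is one of four. -/
lemma involution_cases (f : H8 k → H8 k) (hG : ∀ a, IsGrp a → IsGrp (f a))
    (hf : ∀ a, IsGrp a → f (f a) = a) (h1 : f 1 = 1) (hgh : f (g k * h k) = f (g k) * f (h k)) :
    (f (g k) = g k ∧ f (h k) = h k) ∨ (f (g k) = h k ∧ f (h k) = g k) ∨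
      (f (g k) = g k ∧ f (h k) = g k * h k) ∨ (f (g k) = g k * h k ∧ f (h k) = h k) := by
  have eg := hf _ IsGrp.g
  have eh := hf _ IsGrp.h
  have n1 : (1 : H8 k) ≠ g k := ne_of_coord 0 (by simp)
  have n2 : (1 : H8 k) ≠ h k := ne_of_coord 0 (by simp)
  have n3 : g k ≠ h k := ne_of_coord 1 (by simp)
  have n4 : g k ≠ g k * h k := ne_of_coord 1 (by simp)
  have n5 : h k ≠ g k * h k := ne_of_coord 2 (by simp)
  rcases hG _ IsGrp.g with e1 | e1 | e1 | e1 <;> rcases hG _ IsGrp.h with e2 | e2 | e2 | e2 <;>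
    simp only [e1, e2, h1, hgh, mul_assoc, h_mul_g, h_mul_h, g_mul_g_assoc, h_mul_g_assoc,
      mul_one] at eg eh ⊢ <;>
    simp [g_mul_g, n1, n2, n3, n4, n5, n3.symm, n4.symm, n5.symm] at eg eh ⊢

lemma left_cases (hp : IsMatchedPairOfActions k l r) :
    (l (z k) (g k) = g k ∧ l (z k) (h k) = h k) ∨ (l (z k) (g k) = h k ∧ l (z k) (h k) = g k) ∨
      (l (z k) (g k) = g k ∧ l (z k) (h k) = g k * h k) ∨
      (l (z k) (g k) = g k * h k ∧ l (z k) (h k) = h k) :=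
  involution_cases (l (z k)) (fun _ ha => isGrp_left hp.toIsMatchedPair ha)
    (fun _ ha => left_z_left_z hp.toIsMatchedPair ha) (left_z_one hp.toIsMatchedPair)
    (left_z_gh hp)

lemma right_cases (hp : IsMatchedPairOfActions k l r) :
    (r (g k) (z k) = g k ∧ r (h k) (z k) = h k) ∨ (r (g k) (z k) = h k ∧ r (h k) (z k) = g k) ∨
      (r (g k) (z k) = g k ∧ r (h k) (z k) = g k * h k) ∨
      (r (g k) (z k) = g k * h k ∧ r (h k) (z k) = h k) :=
  involution_cases (fun x => r x (z k)) (fun _ hx => isGrp_right hp.toIsMatchedPair hx)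
    (fun _ hx => right_z_right_z hp.toIsMatchedPair hx) (one_right_z hp.toIsMatchedPair)
    (gh_right_z hp)

/-- If the group acts trivially from the left on `z, gz, hz, ghz`, then it does so from the
right: `x ⇀ a` depends on `a` alone, and the compatibility condition makes `a ↼ x` central. -/
lemma right_trivial_of_left_trivial (hp : IsMatchedPair k l r)
    (hg : ∀ a, IsGrpZ a → l (g k) a = a) (hh : ∀ a, IsGrpZ a → l (h k) a = a) :
    r (z k) (g k) = z k := by
  have hgz : ∀ a, IsGrpZ a → l (g k * z k) a = l (z k) a := fun a ha => by
    rw [← z_mul_h, hp.mul_left, hh a ha]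
  have hhz : ∀ a, IsGrpZ a → l (h k * z k) a = l (z k) a := fun a ha => by
    rw [← z_mul_g, hp.mul_left, hg a ha]
  have hT : ((l (z k)) ∘ₗ (l (z k)) ∘ₗ (l (z k))) ∘ₗ (l (z k)) = LinearMap.id :=
    LinearMap.ext (left_zpow_four hp)
  have hc : ∀ a, IsGrpZ a → TensorProduct.map (r (z k)) LinearMap.id
      (Coalgebra.comul (R := k) a) = TensorProduct.map (r (z k)) LinearMap.id
        (TensorProduct.comm k (H8 k) (H8 k) (Coalgebra.comul (R := k) a)) := by
    intro a ha
    have e1 : TensorProduct.map (TensorProduct.lift l) (TensorProduct.lift r)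
        (Coalgebra.comul (R := k) (z k ⊗ₜ[k] a)) =
          TensorProduct.map (l (z k)) (r (z k)) (Coalgebra.comul (R := k) a) := by
      have : ∀ f : H8 k →ₗ[k] H8 k, TensorProduct.map (l (g k * z k)) f
          (Coalgebra.comul (R := k) a) =
            TensorProduct.map (l (z k)) f (Coalgebra.comul (R := k) a) := fun f =>
        map_comul_congr hgz (fun _ _ => rfl) ha
      rw [map_comul_z_tmul, this, this]
      module
    have e2 : TensorProduct.map (TensorProduct.lift r) (TensorProduct.lift l)
        (Coalgebra.comul (R := k) (z k ⊗ₜ[k] a)) =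
          TensorProduct.map (r (z k)) (l (z k)) (Coalgebra.comul (R := k) a) := by
      have : ∀ f : H8 k →ₗ[k] H8 k, TensorProduct.map f (l (h k * z k))
          (Coalgebra.comul (R := k) a) =
            TensorProduct.map f (l (z k)) (Coalgebra.comul (R := k) a) := fun f =>
        map_comul_congr (fun _ _ => rfl) hhz ha
      rw [map_comul_z_tmul, this, this]
      module
    have h := hp.compat (z k) a
    rw [e1, e2] at h
    have h' := congrArg (fun t => TensorProduct.comm k (H8 k) (H8 k)
      (TensorProduct.map ((l (z k)) ∘ₗ (l (z k)) ∘ₗ (l (z k))) LinearMap.id t)) h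
    simpa only [← map_comm_apply, TensorProduct.comm_comm, TensorProduct.map_map, hT,
      LinearMap.id_comp, eq_comm] using h'
  refine right_z_injective hp ?_
  rw [← hp.mul_right]
  exact eq_of_central (r (z k)) hc IsGrpZ.gz

/-- The mirror image of `right_trivial_of_left_trivial`. -/
lemma left_trivial_of_right_trivial (hp : IsMatchedPair k l r)
    (hg : ∀ x, IsGrpZ x → r x (g k) = x) (hh : ∀ x, IsGrpZ x → r x (h k) = x) :
    l (h k) (z k) = z k := by
  have hgz : ∀ x, IsGrpZ x → r x (g k * z k) = r x (z k) := fun x hx => by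
    rw [hp.mul_right, hg x hx]
  have hhz : ∀ x, IsGrpZ x → r x (h k * z k) = r x (z k) := fun x hx => by
    rw [hp.mul_right, hh x hx]
  have hR : ((r.flip (z k)) ∘ₗ (r.flip (z k)) ∘ₗ (r.flip (z k))) ∘ₗ (r.flip (z k)) =
      LinearMap.id := LinearMap.ext (right_zpow_four hp)
  have hc : ∀ x, IsGrpZ x → TensorProduct.map (l.flip (z k)) LinearMap.id
      (Coalgebra.comul (R := k) x) = TensorProduct.map (l.flip (z k)) LinearMap.id
        (TensorProduct.comm k (H8 k) (H8 k) (Coalgebra.comul (R := k) x)) := by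
    intro x hx
    have e1 : TensorProduct.map (TensorProduct.lift l) (TensorProduct.lift r)
        (Coalgebra.comul (R := k) (x ⊗ₜ[k] z k)) =
          TensorProduct.map (l.flip (z k)) (r.flip (z k)) (Coalgebra.comul (R := k) x) := by
      have : ∀ f : H8 k →ₗ[k] H8 k, TensorProduct.map f (r.flip (h k * z k))
          (Coalgebra.comul (R := k) x) =
            TensorProduct.map f (r.flip (z k)) (Coalgebra.comul (R := k) x) := fun f =>
        map_comul_congr (fun _ _ => rfl) hhz hx
      rw [map_comul_tmul_z, this, this]
      module
    have e2 : TensorProduct.map (TensorProduct.lift r) (TensorProduct.lift l)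
        (Coalgebra.comul (R := k) (x ⊗ₜ[k] z k)) =
          TensorProduct.map (r.flip (z k)) (l.flip (z k)) (Coalgebra.comul (R := k) x) := by
      have : ∀ f : H8 k →ₗ[k] H8 k, TensorProduct.map (r.flip (g k * z k)) f
          (Coalgebra.comul (R := k) x) =
            TensorProduct.map (r.flip (z k)) f (Coalgebra.comul (R := k) x) := fun f =>
        map_comul_congr hgz (fun _ _ => rfl) hx
      rw [map_comul_tmul_z, this, this]
      module
    have h := hp.compat x (z k)
    rw [e1, e2, ← map_comm_apply] at h
    have h' := congrArg (TensorProduct.map LinearMap.id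
      ((r.flip (z k)) ∘ₗ (r.flip (z k)) ∘ₗ (r.flip (z k)))) h
    simpa only [TensorProduct.map_map, hR, LinearMap.id_comp] using h'
  refine left_z_injective hp ?_
  rw [← hp.mul_left, z_mul_h]
  exact eq_of_central (l.flip (z k)) hc IsGrpZ.gz

end MatchedPair

/-! ### Stability of the span of `z, gz, hz, ghz` -/

section

variable {k V : Type*} [Field k] [CharZero k] [AddCommGroup V] [Module k V]

lemma linearMap_ext_grp {f f' : H8 k →ₗ[k] V} (h1 : ∀ a, IsGrp a → f a = f' a)
    (h2 : ∀ a, IsGrpZ a → f a = f' a) : f = f' := by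
  ext x
  rw [eq_sum_coord x]
  simp only [map_add, map_smul, h1 _ IsGrp.one, h1 _ IsGrp.g, h1 _ IsGrp.h, h1 _ IsGrp.gh,
    h2 _ IsGrpZ.z, h2 _ IsGrpZ.gz, h2 _ IsGrpZ.hz, h2 _ IsGrpZ.ghz]

/-- The projection onto the span of `1, g, h, gh` along the span of `z, gz, hz, ghz`. -/
def grpProj (k : Type*) [Field k] [CharZero k] : H8 k →ₗ[k] H8 k :=
  (coord 0).smulRight 1 + (coord 1).smulRight (g k) + (coord 2).smulRight (h k) +
    (coord 3).smulRight (g k * h k)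

lemma grpProj_apply (x : H8 k) : grpProj k x =
    coord 0 x • 1 + coord 1 x • g k + coord 2 x • h k + coord 3 x • (g k * h k) := rfl

lemma grpProj_grp {a : H8 k} (ha : IsGrp a) : grpProj k a = a := by
  rcases ha with rfl | rfl | rfl | rfl <;> simp [grpProj_apply]

lemma grpProj_grpZ {a : H8 k} (ha : IsGrpZ a) : grpProj k a = 0 := by
  rcases ha with rfl | rfl | rfl | rfl <;> simp [grpProj_apply]

lemma map_grpProj_comul (x : H8 k) : TensorProduct.map (grpProj k) (LinearMap.id - grpProj k)
    (Coalgebra.comul (R := k) x) = 0 := by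
  have : TensorProduct.map (grpProj k) (LinearMap.id - grpProj k) ∘ₗ
      Coalgebra.comul (R := k) = 0 := by
    refine linearMap_ext_grp (fun a ha => ?_) fun a ha => ?_
    · simp [ha.comul, grpProj_grp ha]
    · rw [LinearMap.comp_apply, map_comul_congr (p' := 0) (fun b hb => grpProj_grpZ hb)
        (fun _ _ => rfl) ha]
      simp
  exact LinearMap.congr_fun this x

variable {l r : H8 k →ₗ[k] H8 k →ₗ[k] H8 k}

/-- The span of `z, gz, hz, ghz` is stable under the action of `z`. With `T = z ⇀ ·` and the
projection `q` onto the span of the group, `Δ (T a)` having no component in the mixed summand gives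
`q (T a₁) ⊗ (1 - q) (T a₂) = 0`; the second factor is invertible on the span of `z, gz, hz, ghz`. -/
lemma grpProj_left_z (hp : IsMatchedPairOfActions k l r) {a : H8 k} (ha : IsGrpZ a) :
    grpProj k (l (z k) a) = 0 := by
  have hm := hp.toIsMatchedPair
  have hK : ∀ {x}, IsGrp x → grpProj k ∘ₗ l (x * z k) = grpProj k ∘ₗ l (z k) := by
    intro x hx
    have : grpProj k ∘ₗ l x = grpProj k := by
      refine linearMap_ext_grp (fun b hb => ?_) fun b hb => ?_
      · rw [LinearMap.comp_apply, left_grp_grp hm hx hb]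
      · rw [LinearMap.comp_apply, grpProj_grpZ (isGrpZ_left hp hx hb), grpProj_grpZ hb]
    ext b
    rw [LinearMap.comp_apply, hm.mul_left, ← LinearMap.comp_apply, this, LinearMap.comp_apply]
  have e1 := map_grpProj_comul (l (z k) a)
  rw [hm.comul_left, map_comul_z_tmul] at e1
  simp only [map_smul, map_add, map_sub, TensorProduct.map_map, hK IsGrp.g] at e1
  replace e1 : TensorProduct.map (grpProj k ∘ₗ l (z k)) ((LinearMap.id - grpProj k) ∘ₗ l (z k))
      (Coalgebra.comul (R := k) a) = 0 := by
    rw [← e1]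
    module
  -- a left inverse of the second factor
  have hη : (Coalgebra.counit (R := k) ∘ₗ (LinearMap.id - grpProj k) ∘ₗ l (z k) ∘ₗ l (z k) ∘ₗ
      l (z k)) ∘ₗ ((LinearMap.id - grpProj k) ∘ₗ l (z k)) =
        Coalgebra.counit (R := k) ∘ₗ (LinearMap.id - grpProj k) := by
    have hG : ∀ u, (LinearMap.id - grpProj k : H8 k →ₗ[k] H8 k)
        (l (z k) (l (z k) (l (z k) (grpProj k u)))) = 0 := by
      have h3 : ∀ {b}, IsGrp b → (LinearMap.id - grpProj k : H8 k →ₗ[k] H8 k)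
          (l (z k) (l (z k) (l (z k) b))) = 0 := fun {b} hb => by
        rw [LinearMap.sub_apply, grpProj_grp (isGrp_left hm (isGrp_left hm (isGrp_left hm hb))),
          LinearMap.id_apply, sub_self]
      intro u
      simp only [grpProj_apply u, map_add, map_smul, h3 IsGrp.one, h3 IsGrp.g, h3 IsGrp.h,
        h3 IsGrp.gh, smul_zero, add_zero]
    ext u
    simp only [LinearMap.comp_apply]
    congr 1
    have : (LinearMap.id - grpProj k : H8 k →ₗ[k] H8 k) (l (z k) u) =
        l (z k) u - grpProj k (l (z k) u) := rfl
    rw [this, map_sub, map_sub, map_sub, map_sub, hG, left_zpow_four hm, sub_zero]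
  have e2 := congrArg (TensorProduct.map LinearMap.id (Coalgebra.counit (R := k) ∘ₗ
    (LinearMap.id - grpProj k) ∘ₗ l (z k) ∘ₗ l (z k) ∘ₗ l (z k))) e1
  rw [TensorProduct.map_map, hη, map_zero, LinearMap.id_comp, map_comul_congr (fun _ _ => rfl)
    (q' := Coalgebra.counit (R := k)) (fun b hb => by simp [grpProj_grpZ hb]) ha] at e2
  have e3 : TensorProduct.map (grpProj k ∘ₗ l (z k)) (Coalgebra.counit (R := k))
      (Coalgebra.comul (R := k) a) = grpProj k (l (z k) a) ⊗ₜ 1 := by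
    have := congrArg (TensorProduct.map (grpProj k ∘ₗ l (z k)) LinearMap.id)
      (Coalgebra.lTensor_counit_comul (R := k) a)
    rwa [LinearMap.lTensor, TensorProduct.map_map, LinearMap.comp_id, LinearMap.id_comp,
      TensorProduct.map_tmul] at this
  rw [e3] at e2
  simpa using congrArg (TensorProduct.rid k (H8 k)) e2

end

/-! ### The action of `z` on the group -/

section Cases

variable {k : Type*} [Field k] [CharZero k] {l r : H8 k →ₗ[k] H8 k →ₗ[k] H8 k}

lemma eq_of_grpProj_eq_zero {u : H8 k} (hu : grpProj k u = 0) : ∃ a b c d : k,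
    u = a • z k + b • (g k * z k) + c • (h k * z k) + d • (g k * (h k * z k)) := by
  refine ⟨coord 4 u, coord 5 u, coord 6 u, coord 7 u, ?_⟩
  conv_lhs => rw [eq_sum_coord u, ← grpProj_apply, hu, zero_add]

lemma mul_g_of_grpProj {u : H8 k} (hu : grpProj k u = 0) : u * g k = h k * u := by
  obtain ⟨a, b, c, d, rfl⟩ := eq_of_grpProj_eq_zero hu
  simp [add_mul, mul_add, mul_assoc, z_mul_g, h_mul_g_assoc]

lemma mul_h_of_grpProj {u : H8 k} (hu : grpProj k u = 0) : u * h k = g k * u := by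
  obtain ⟨a, b, c, d, rfl⟩ := eq_of_grpProj_eq_zero hu
  simp [add_mul, mul_add, mul_assoc, z_mul_h, h_mul_g_assoc]

lemma mul_g_assoc_of_grpProj {u : H8 k} (hu : grpProj k u = 0) (x : H8 k) :
    u * (g k * x) = h k * (u * x) := by
  rw [← mul_assoc, mul_g_of_grpProj hu, mul_assoc]

lemma left_of_grpProj (hp : IsMatchedPairOfActions k l r) {x u : H8 k} (hx : IsGrp x)
    (hu : grpProj k u = 0) : l x u = x * (u * r x (z k)) := by
  obtain ⟨a, b, c, d, rfl⟩ := eq_of_grpProj_eq_zero hu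
  simp only [map_add, map_smul, left_grp hp hx IsGrpZ.z, left_grp hp hx IsGrpZ.gz,
    left_grp hp hx IsGrpZ.hz, left_grp hp hx IsGrpZ.ghz, add_mul, mul_add, smul_mul_assoc,
    mul_smul_comm]

lemma grpProj_left (hp : IsMatchedPairOfActions k l r) {x u : H8 k} (hx : IsGrp x)
    (hu : grpProj k u = 0) : grpProj k (l x u) = 0 := by
  obtain ⟨a, b, c, d, rfl⟩ := eq_of_grpProj_eq_zero hu
  simp only [map_add, map_smul, grpProj_grpZ (isGrpZ_left hp hx IsGrpZ.z),
    grpProj_grpZ (isGrpZ_left hp hx IsGrpZ.gz), grpProj_grpZ (isGrpZ_left hp hx IsGrpZ.hz),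
    grpProj_grpZ (isGrpZ_left hp hx IsGrpZ.ghz), smul_zero, add_zero]

/-- The action of `z` on `xz` with `x` in the group, in terms of `z ⇀ z`. -/
lemma left_z_grp_mul_z (hp : IsMatchedPairOfActions k l r) {x y : H8 k} (hx : IsGrp x)
    (hy : IsGrp y) (hxy : z k * x = y * z k) :
    l (z k) (x * z k) = y * (l (z k) (z k) * r y (z k)) * r (l (z k) x) (z k) := by
  have hm := hp.toIsMatchedPair
  have hσ := isGrp_left hm hx
  rw [left_z_mul hm hx, right_grp hp IsGrpZ.z hx, hxy, hp.mul_left, hp.mul_left,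
    left_of_grpProj hp hσ (grpProj_left hp hy (grpProj_left_z hp IsGrpZ.z)), hσ.mul_self_mul,
    left_of_grpProj hp hy (grpProj_left_z hp IsGrpZ.z)]

lemma left_z_gz (hp : IsMatchedPairOfActions k l r) : l (z k) (g k * z k) =
    h k * (l (z k) (z k) * (r (h k) (z k) * r (l (z k) (g k)) (z k))) := by
  rw [left_z_grp_mul_z hp IsGrp.g IsGrp.h (z_mul_g k)]
  simp only [mul_assoc]

lemma left_z_hz (hp : IsMatchedPairOfActions k l r) : l (z k) (h k * z k) =
    g k * (l (z k) (z k) * (r (g k) (z k) * r (l (z k) (h k)) (z k))) := by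
  rw [left_z_grp_mul_z hp IsGrp.h IsGrp.g (z_mul_h k)]
  simp only [mul_assoc]

lemma left_z_ghz (hp : IsMatchedPairOfActions k l r) : l (z k) (g k * (h k * z k)) =
    g k * (h k * (l (z k) (z k) *
      (r (g k) (z k) * (r (h k) (z k) * r (l (z k) (g k) * l (z k) (h k)) (z k))))) := by
  rw [← mul_assoc, left_z_grp_mul_z hp IsGrp.gh IsGrp.gh
    (by rw [z_mul_g_assoc, z_mul_h, h_mul_g_assoc, mul_assoc]), gh_right_z hp, left_z_gh hp]
  simp only [mul_assoc]

lemma left_z_z_eq (hp : IsMatchedPairOfActions k l r) : ∃ a b c d : k, a + b + c + d = 1 ∧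
    l (z k) (z k) = a • z k + b • (g k * z k) + c • (h k * z k) + d • (g k * (h k * z k)) := by
  obtain ⟨a, b, c, d, hw⟩ := eq_of_grpProj_eq_zero (grpProj_left_z hp IsGrpZ.z)
  refine ⟨a, b, c, d, ?_, hw⟩
  have := hp.counit_left (z k) (z k)
  rw [hw] at this
  simpa [counit_g, counit_h, counit_z] using this

lemma left_z_ne (hp : IsMatchedPair k l r) {x : H8 k} (hx : x ≠ z k) :
    l (z k) x ≠ l (z k) (z k) :=
  fun e => hx (left_z_injective hp e)

lemma gz_ne_z : g k * z k ≠ z k := ne_of_coord 4 (by simp)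

lemma hz_ne_z : h k * z k ≠ z k := ne_of_coord 4 (by simp)

/-- The equation `Δ(z ⇀ z) = (z₁ ⇀ z₁) ⊗ (z₂ ⇀ z₂)` written out, with `gz = zh` and `hz = zg` acting
as `z ⇀ (h ⇀ ·)` and `z ⇀ (g ⇀ ·)`. -/
lemma comul_left_z_z (hp : IsMatchedPair k l r) :
    Coalgebra.comul (R := k) (l (z k) (z k)) = (1 / 4 : k) • (
      (l (z k) (z k) ⊗ₜ l (z k) (z k) + l (z k) (g k * z k) ⊗ₜ l (z k) (z k) +
        l (z k) (z k) ⊗ₜ l (z k) (h k * z k) - l (z k) (g k * z k) ⊗ₜ l (z k) (h k * z k)) +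
      (l (z k) (l (h k) (z k)) ⊗ₜ l (z k) (z k) + l (z k) (l (h k) (g k * z k)) ⊗ₜ l (z k) (z k) +
        l (z k) (l (h k) (z k)) ⊗ₜ l (z k) (h k * z k) -
        l (z k) (l (h k) (g k * z k)) ⊗ₜ l (z k) (h k * z k)) +
      (l (z k) (z k) ⊗ₜ l (z k) (l (g k) (z k)) + l (z k) (g k * z k) ⊗ₜ l (z k) (l (g k) (z k)) +
        l (z k) (z k) ⊗ₜ l (z k) (l (g k) (h k * z k)) -
        l (z k) (g k * z k) ⊗ₜ l (z k) (l (g k) (h k * z k))) -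
      (l (z k) (l (h k) (z k)) ⊗ₜ l (z k) (l (g k) (z k)) +
        l (z k) (l (h k) (g k * z k)) ⊗ₜ l (z k) (l (g k) (z k)) +
        l (z k) (l (h k) (z k)) ⊗ₜ l (z k) (l (g k) (h k * z k)) -
        l (z k) (l (h k) (g k * z k)) ⊗ₜ l (z k) (l (g k) (h k * z k)))) := by
  have e1 : ∀ x, l (g k * z k) x = l (z k) (l (h k) x) := fun x => by
    rw [← z_mul_h, hp.mul_left]
  have e2 : ∀ x, l (h k * z k) x = l (z k) (l (g k) x) := fun x => by
    rw [← z_mul_g, hp.mul_left]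
  rw [hp.comul_left, map_comul_z_tmul, comul_z']
  simp only [map_smul, map_add, map_sub, TensorProduct.map_tmul, e1, e2]
  module

/-- The action of `z² = ½ (1 + g + h - gh)` on `z`. -/
lemma left_z_left_z_z (hp : IsMatchedPair k l r) : l (z k) (l (z k) (z k)) =
    (1 / 2 : k) • (z k + l (g k) (z k) + l (h k) (z k) - l (g k) (l (h k) (z k))) := by
  rw [← hp.mul_left, z_mul_z, ← hp.mul_left]
  simp only [map_smul, map_add, map_sub, LinearMap.smul_apply, LinearMap.add_apply,
    LinearMap.sub_apply, hp.one_left]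

/-- The two cases in which `z ⇀ ·` and `· ↼ z` agree on the group, fix one of `g, h`, and move the
other one to `gh`. The comultiplication of `z ⇀ z` forces all its coordinates to vanish, so that
`ε(z ⇀ z) = 0`. -/
lemma false_of_moves_to_gh (hp : IsMatchedPairOfActions k l r)
    (H : (l (z k) (g k) = g k ∧ l (z k) (h k) = g k * h k ∧ r (g k) (z k) = g k ∧
        r (h k) (z k) = g k * h k) ∨
      (l (z k) (g k) = g k * h k ∧ l (z k) (h k) = h k ∧ r (g k) (z k) = g k * h k ∧
        r (h k) (z k) = h k)) : False := by
  have hw := grpProj_left_z hp IsGrpZ.z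
  have hz := left_z_hz hp
  have gz := left_z_gz hp
  have ghz := left_z_ghz hp
  have h5 := gh_right_z hp
  have gg := fun a ha => left_grp hp IsGrp.g (a := a) ha
  have hh := fun a ha => left_grp hp IsGrp.h (a := a) ha
  have hΔ := comul_left_z_z hp.toIsMatchedPair
  obtain ⟨a, b, c, d, e0, hw'⟩ := left_z_z_eq hp
  rcases H with ⟨h1, h2, h3, h4⟩ | ⟨h1, h2, h3, h4⟩
  all_goals
    simp only [h1, h2, h3, h4, h5, g_mul_g, h_mul_h, h_mul_g, h_mul_g_assoc, h_mul_h_assoc,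
      g_mul_g_assoc, mul_g_of_grpProj hw, mul_h_of_grpProj hw, mul_g_assoc_of_grpProj hw,
      mul_one, mul_assoc] at gz hz ghz
    simp only [gg _ IsGrpZ.z, gg _ IsGrpZ.hz, hh _ IsGrpZ.z, hh _ IsGrpZ.gz, h3, h4, mul_assoc,
      z_mul_g, z_mul_h, z_mul_g_assoc, h_mul_g_assoc, h_mul_h_assoc, g_mul_g_assoc, gz, hz,
      ghz] at hΔ
    simp only [hw', map_add, map_smul, comul_z', comul_gz, comul_hz, comul_ghz, mul_add,
      mul_smul_comm, h_mul_g_assoc, h_mul_h_assoc, g_mul_g_assoc] at hΔ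
    have key := fun m n => congrArg (coord₂ m n) hΔ
    simp only [map_add, map_smul, map_sub, coord₂_tmul, coord_z, coord_gz, coord_hz, coord_ghz,
      smul_eq_mul] at key
    have e45 := key 4 5
    have e47 := key 4 7
    have e54 := key 5 4
    have e56 := key 5 6
    have e65 := key 6 5
    have e74 := key 7 4
    clear key hΔ
    simp at e45 e47 e54 e56 e65 e74
    have hbc : b = c := by linear_combination 2 * (e74 - e47)
    have hab : a = b := by linear_combination 2 * (e54 - e45)
    have had : a = d := by linear_combination 2 * (e65 - e56)
    subst hab hbc had
    have ha : a = 0 := by linear_combination e45 - e47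
    simp [ha] at e0

lemma z_mul_cancel {x y : H8 k} (h : z k * x = z k * y) : x = y := by
  rw [← z_pow_four x, h, z_pow_four]

lemma mul_z_cancel {x y : H8 k} (h : x * z k = y * z k) : x = y := by
  have hz : z k * (z k * (z k * z k)) = 1 := by simpa using z_pow_four (1 : H8 k)
  rw [← mul_one x, ← hz, ← mul_assoc, h, mul_assoc, hz, mul_one]

/-- If `↼ z` exchanges `g` and `h`, then `g` acts trivially from the left. -/
lemma left_g_eq_id (hp : IsMatchedPairOfActions k l r) (hg : r (g k) (z k) = h k) :
    l (g k) = LinearMap.id :=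
  linearMap_ext_grp (fun a ha => left_grp_grp hp.toIsMatchedPair IsGrp.g ha) <| by
    rintro a (rfl | rfl | rfl | rfl) <;> rw [left_grp hp IsGrp.g (by simp [IsGrpZ]), hg] <;>
      simp [z_mul_h, mul_assoc, h_mul_g_assoc, g_mul_g_assoc]

lemma left_h_eq_id (hp : IsMatchedPairOfActions k l r) (hh : r (h k) (z k) = g k) :
    l (h k) = LinearMap.id :=
  linearMap_ext_grp (fun a ha => left_grp_grp hp.toIsMatchedPair IsGrp.h ha) <| by
    rintro a (rfl | rfl | rfl | rfl) <;> rw [left_grp hp IsGrp.h (by simp [IsGrpZ]), hh] <;>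
      simp [z_mul_g, mul_assoc, h_mul_g_assoc, h_mul_h_assoc]

/-- The action of `z` on the group is one of two, and determines the right action of `z` on it.
If one of `z ⇀ ·` and `· ↼ z` exchanges `g` and `h`, the group acts trivially on the opposite side
and the other one exchanges them as well. Otherwise there are nine combinations left; in six of them
`z ⇀ ·` is not injective on `z, gz, hz`, and two are excluded by `false_of_moves_to_gh`. -/
lemma left_right_cases (hp : IsMatchedPairOfActions k l r) :
    (l (z k) (g k) = g k ∧ l (z k) (h k) = h k ∧ r (g k) (z k) = g k ∧ r (h k) (z k) = h k) ∨
      (l (z k) (g k) = h k ∧ l (z k) (h k) = g k ∧ r (g k) (z k) = h k ∧ r (h k) (z k) = g k) := by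
  have hm := hp.toIsMatchedPair
  have hw := grpProj_left_z hp IsGrpZ.z
  have hz := left_z_hz hp
  have gz := left_z_gz hp
  have h5 := gh_right_z hp
  have ngz := left_z_ne hm (gz_ne_z (k := k))
  have nhz := left_z_ne hm (hz_ne_z (k := k))
  by_cases hσ : l (z k) (g k) = h k
  · have h2 : l (z k) (h k) = g k := by rw [← hσ, left_z_left_z hm IsGrp.g]
    have hx : ∀ x, IsGrpZ x → r x (g k) = x := by
      rintro x (rfl | rfl | rfl | rfl) <;> rw [right_grp hp (by simp [IsGrpZ]) IsGrp.g, hσ] <;>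
        simp [z_mul_g, mul_assoc, h_mul_g_assoc, h_mul_h_assoc]
    have hy : ∀ x, IsGrpZ x → r x (h k) = x := by
      rintro x (rfl | rfl | rfl | rfl) <;> rw [right_grp hp (by simp [IsGrpZ]) IsGrp.h, h2] <;>
        simp [z_mul_h, mul_assoc, h_mul_g_assoc, g_mul_g_assoc]
    have h4 : r (h k) (z k) = g k := z_mul_cancel (by
      rw [z_mul_g, ← left_grp_mul hp IsGrp.h IsGrpZ.z, left_trivial_of_right_trivial hm hx hy])
    have h3 : r (g k) (z k) = h k := by rw [← h4, right_z_right_z hm IsGrp.h]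
    exact Or.inr ⟨hσ, h2, h3, h4⟩
  by_cases hτ : r (g k) (z k) = h k
  · have h4 : r (h k) (z k) = g k := by rw [← hτ, right_z_right_z hm IsGrp.g]
    refine absurd (mul_z_cancel ?_) hσ
    rw [← z_mul_g, ← mul_right_grp hp IsGrpZ.z IsGrp.g, right_trivial_of_left_trivial hm
      (fun a _ => by rw [left_g_eq_id hp hτ, LinearMap.id_apply])
      fun a _ => by rw [left_h_eq_id hp h4, LinearMap.id_apply]]
  left
  rcases left_cases hp with ⟨h1, h2⟩ | ⟨h1, h2⟩ | ⟨h1, h2⟩ | ⟨h1, h2⟩ <;>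
    rcases right_cases hp with ⟨h3, h4⟩ | ⟨h3, h4⟩ | ⟨h3, h4⟩ | ⟨h3, h4⟩
  all_goals first
    | exact ⟨h1, h2, h3, h4⟩
    | exact absurd h1 hσ
    | exact absurd h3 hτ
    | exact (false_of_moves_to_gh hp (Or.inl ⟨h1, h2, h3, h4⟩)).elim
    | exact (false_of_moves_to_gh hp (Or.inr ⟨h1, h2, h3, h4⟩)).elim
    | skip
  all_goals
    simp only [h1, h2, h3, h4, h5, h_mul_h, h_mul_g, h_mul_g_assoc, h_mul_h_assoc,
      g_mul_g_assoc, mul_g_of_grpProj hw, mul_h_of_grpProj hw, mul_g_assoc_of_grpProj hw,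
      mul_one, mul_assoc] at gz hz
    first | exact absurd gz ngz | exact absurd hz nhz

end Cases

/-! ### The equations for `z ⇀ z` -/

section Solutions

variable {k : Type*} [Field k] [CharZero k] {l r : H8 k →ₗ[k] H8 k →ₗ[k] H8 k}

/-- The comultiplication of `w = z ⇀ z = a z + b gz + c hz + d ghz` gives `a b = 0`; the rest
follows from `z ⇀ w = z² ⇀ z` and `ε(w) = 1`. -/
lemma coeff_of_left_z_fix (hp : IsMatchedPairOfActions k l r) (h1 : l (z k) (g k) = g k)
    (h2 : l (z k) (h k) = h k) (h3 : r (g k) (z k) = g k) (h4 : r (h k) (z k) = h k) :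
    ∃ a b : k, a + b = 1 ∧ a * b = 1 / 2 ∧
      (l (z k) (z k) = a • (g k * z k) + b • (h k * z k) ∨
        l (z k) (z k) = a • z k + b • (g k * (h k * z k))) := by
  have hw := grpProj_left_z hp IsGrpZ.z
  have hz := left_z_hz hp
  have gz := left_z_gz hp
  have ghz := left_z_ghz hp
  have h5 := gh_right_z hp
  have gg := fun a ha => left_grp hp IsGrp.g (a := a) ha
  have hh := fun a ha => left_grp hp IsGrp.h (a := a) ha
  have hΔ := comul_left_z_z hp.toIsMatchedPair
  have hzz := left_z_left_z_z hp.toIsMatchedPair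
  obtain ⟨a, b, c, d, e0, hw'⟩ := left_z_z_eq hp
  simp only [h1, h2, h3, h4, h5, g_mul_g, h_mul_h, h_mul_g, h_mul_g_assoc, h_mul_h_assoc,
    g_mul_g_assoc, mul_h_of_grpProj hw, mul_g_assoc_of_grpProj hw,
    mul_one] at gz hz ghz
  simp only [gg _ IsGrpZ.z, gg _ IsGrpZ.ghz, gg _ IsGrpZ.hz, hh _ IsGrpZ.z, hh _ IsGrpZ.gz, h3, h4,
    mul_assoc, z_mul_g, z_mul_h, h_mul_g_assoc, h_mul_h_assoc, g_mul_g_assoc, gz, hz,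
    ghz] at hΔ hzz
  simp only [hw', map_add, map_smul, comul_z', comul_gz, comul_hz, comul_ghz, mul_add, gz, hz, ghz,
    mul_smul_comm, h_mul_g_assoc, h_mul_h_assoc, g_mul_g_assoc] at hΔ hzz
  have key := fun m n => congrArg (coord₂ m n) hΔ
  have key' := fun m => congrArg (coord m) hzz
  simp only [map_add, map_smul, map_sub, coord₂_tmul, coord_z, coord_gz, coord_hz, coord_ghz,
    smul_eq_mul] at key key'
  have z1 := key' 4
  have z2 := key' 5
  have z3 := key' 6
  have z4 := key' 7
  have e44 := key 4 4
  have e45 := key 4 5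
  have e46 := key 4 6
  have e56 := key 5 6
  clear key hΔ key' hzz
  simp at e44 e45 e46 e56 z1 z2 z3 z4
  have h : a * b = 0 := by grind only
  rcases mul_eq_zero.1 h with rfl | rfl
  · have hbc : b * c = 1 / 2 := by linear_combination z4 / 2
    have hd : d = 0 := by
      have hc : c ≠ 0 := by rintro rfl; norm_num at hbc
      exact (mul_eq_zero.1 (by linear_combination z2 / 2 : c * d = 0)).resolve_left hc
    exact ⟨b, c, by linear_combination e0 - hd, hbc, Or.inl (by rw [hw', hd]; module)⟩
  · have had : a * d = 1 / 2 := by linear_combination z4 / 2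
    have hc : c = 0 := by
      have ha : a ≠ 0 := by rintro rfl; norm_num at had
      exact (mul_eq_zero.1 (by linear_combination z3 / 2 : a * c = 0)).resolve_left ha
    exact ⟨a, d, by linear_combination e0 - hc, had, Or.inr (by rw [hw', hc]; module)⟩

lemma z_pow_three (k : Type*) [Field k] : z k ^ 3 =
    (1 / 2 : k) • (z k + g k * z k + h k * z k - g k * (h k * z k)) := by
  rw [pow_succ, sq, z_mul_z]
  simp [add_mul, sub_mul, mul_assoc]

/-- The comultiplication of `w = z ⇀ z = a z + b gz + c hz + d ghz` gives `b = c = ½`. Then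
`d = -a` by `ε(w) = 1`, and `z ⇀ w = z² ⇀ z` gives `a² = ¼`. -/
lemma coeff_of_left_z_swap (hp : IsMatchedPairOfActions k l r) (h1 : l (z k) (g k) = h k)
    (h2 : l (z k) (h k) = g k) (h3 : r (g k) (z k) = h k) (h4 : r (h k) (z k) = g k) :
    l (z k) (z k) = z k ^ 3 ∨ l (z k) (z k) = g k * h k * z k ^ 3 := by
  have hw := grpProj_left_z hp IsGrpZ.z
  have hz := left_z_hz hp
  have gz := left_z_gz hp
  have ghz := left_z_ghz hp
  have h5 := gh_right_z hp
  have gg := fun a ha => left_grp hp IsGrp.g (a := a) ha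
  have hh := fun a ha => left_grp hp IsGrp.h (a := a) ha
  have hΔ := comul_left_z_z hp.toIsMatchedPair
  have hzz := left_z_left_z_z hp.toIsMatchedPair
  obtain ⟨a, b, c, d, e0, hw'⟩ := left_z_z_eq hp
  simp only [h1, h2, h3, h4, h5, g_mul_g, h_mul_h, h_mul_g,
    g_mul_g_assoc,
    mul_one] at gz hz ghz
  simp only [gg _ IsGrpZ.z, gg _ IsGrpZ.hz, hh _ IsGrpZ.z, hh _ IsGrpZ.gz, h3, h4, mul_assoc,
    z_mul_g, z_mul_h, h_mul_g_assoc, h_mul_h_assoc, g_mul_g_assoc, gz, hz] at hΔ hzz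
  simp only [hw', map_add, map_smul, comul_z', comul_gz, comul_hz, comul_ghz, mul_add, gz, hz, ghz,
    mul_smul_comm, h_mul_g_assoc, h_mul_h_assoc, g_mul_g_assoc] at hΔ hzz
  have key := fun m n => congrArg (coord₂ m n) hΔ
  have key' := fun m => congrArg (coord m) hzz
  simp only [map_add, map_smul, map_sub, coord₂_tmul, coord_z, coord_gz, coord_hz, coord_ghz,
    smul_eq_mul] at key key'
  have z1 := key' 4
  have z2 := key' 5
  have z3 := key' 6
  have z4 := key' 7
  have e44 := key 4 4
  have e45 := key 4 5
  have e46 := key 4 6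
  have e47 := key 4 7
  have e56 := key 5 6
  clear key hΔ key' hzz
  simp at e44 e45 e46 e47 e56 z1 z2 z3 z4
  have hb : b = 1 / 2 := by grind only
  have hc : c = 1 / 2 := by grind only
  subst hb hc
  have hd : d = -a := by linear_combination e0
  have ha : (a - 1 / 2) * (a + 1 / 2) = 0 := by
    rw [hd] at z4
    linear_combination -z4 / 2
  rw [mul_assoc, z_pow_three k, hw', hd]
  rcases mul_eq_zero.1 ha with ha | ha
  · left
    rw [sub_eq_zero.1 ha]
    module
  · right
    rw [eq_neg_of_add_eq_zero_left ha]
    simp [mul_add, mul_sub, h_mul_g_assoc, g_mul_g_assoc, h_mul_h_assoc]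
    module

lemma eq_ofTable {T : Fin 8 → Fin 8 → H8 k}
    (hT : ∀ m n, l (monomial k m) (monomial k n) = T m n) : l = ofTable T :=
  (basis k).ext fun m => (basis k).ext fun n => by
    rw [basis_apply, basis_apply, hT, ofTable_apply]

lemma eq_tableA_or_tableB (hp : IsMatchedPairOfActions k l r) (h1 : l (z k) (g k) = g k)
    (h2 : l (z k) (h k) = h k) (h3 : r (g k) (z k) = g k) (h4 : r (h k) (z k) = h k) :
    ∃ a b : k, a + b = 1 ∧ a * b = 1 / 2 ∧
      (l = ofTable (tableA a b) ∨ l = ofTable (tableB a b)) := by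
  have hm := hp.toIsMatchedPair
  have gz := left_z_gz hp
  have hz := left_z_hz hp
  have ghz := left_z_ghz hp
  obtain ⟨a, b, hab, hab', hw⟩ := coeff_of_left_z_fix hp h1 h2 h3 h4
  refine ⟨a, b, hab, hab', hw.imp (fun hw => ?_) fun hw => ?_⟩
  all_goals
    refine eq_ofTable fun m n => ?_
    fin_cases m <;> fin_cases n <;>
      simp [monomial, tableA, tableB, mul_assoc, hm.mul_left, hm.one_left, h1, h2, h3, h4, gz, hz,
        ghz, left_z_gh hp, gh_right_z hp, hw, left_z_one hm, left_grp_grp hm IsGrp.g IsGrp.one,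
        left_grp_grp hm IsGrp.g IsGrp.g, left_grp_grp hm IsGrp.g IsGrp.h,
        left_grp_grp hm IsGrp.g IsGrp.gh, left_grp_grp hm IsGrp.h IsGrp.one,
        left_grp_grp hm IsGrp.h IsGrp.g, left_grp_grp hm IsGrp.h IsGrp.h,
        left_grp_grp hm IsGrp.h IsGrp.gh, left_grp hp IsGrp.g IsGrpZ.z,
        left_grp hp IsGrp.g IsGrpZ.gz, left_grp hp IsGrp.g IsGrpZ.hz,
        left_grp hp IsGrp.g IsGrpZ.ghz, left_grp hp IsGrp.h IsGrpZ.z,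
        left_grp hp IsGrp.h IsGrpZ.gz, left_grp hp IsGrp.h IsGrpZ.hz,
        left_grp hp IsGrp.h IsGrpZ.ghz, z_mul_g, z_mul_h, z_mul_g_assoc, h_mul_g,
        g_mul_g, h_mul_h, h_mul_g_assoc, g_mul_g_assoc, h_mul_h_assoc, mul_add, add_mul]

lemma eq_tableC_or_tableD (hp : IsMatchedPairOfActions k l r) (h1 : l (z k) (g k) = h k)
    (h2 : l (z k) (h k) = g k) (h3 : r (g k) (z k) = h k) (h4 : r (h k) (z k) = g k) :
    l = ofTable (tableC k) ∨ l = ofTable (tableD k) := by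
  have hm := hp.toIsMatchedPair
  have gz := left_z_gz hp
  have hz := left_z_hz hp
  have ghz := left_z_ghz hp
  simp only [h1, h2, h3, h4, h_mul_g, g_mul_g, h_mul_h, gh_right_z hp, mul_one,
    g_mul_g_assoc] at gz hz ghz
  have lg := left_g_eq_id hp h3
  have lh := left_h_eq_id hp h4
  refine (coeff_of_left_z_swap hp h1 h2 h3 h4).imp (fun hw => ?_) fun hw => ?_
  all_goals
    refine eq_ofTable fun m n => ?_
    fin_cases m <;> fin_cases n <;>
      simp [monomial, tableC, tableD, mul_assoc, hm.mul_left, hm.one_left, lg, lh, h1, h2, gz, hz,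
        ghz, left_z_gh hp, hw, left_z_one hm, h_mul_g, h_mul_g_assoc, g_mul_g_assoc, h_mul_h_assoc]

/-- The left action of a matched pair is one of the six tabulated ones: `a + b = 1` and `ab = ½`
have the solutions `(1 ± i) / 2`. -/
lemma exists_eq_leftAction {i : k} (hi : i ^ 2 = -1) (hp : IsMatchedPairOfActions k l r) :
    ∃ c, l = leftAction i c := by
  rcases left_right_cases hp with ⟨h1, h2, h3, h4⟩ | ⟨h1, h2, h3, h4⟩
  · obtain ⟨a, b, hab, hab', h⟩ := eq_tableA_or_tableB hp h1 h2 h3 h4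
    have ha : (2 * a - 1 + i) * (2 * a - 1 - i) = 0 := by
      linear_combination -hi + 4 * a * hab - 4 * hab'
    rcases mul_eq_zero.1 ha with ha | ha
    · obtain rfl : a = (1 - i) / 2 := by linear_combination ha / 2
      obtain rfl : b = (1 + i) / 2 := by linear_combination hab
      rcases h with rfl | rfl
      exacts [⟨0, rfl⟩, ⟨2, rfl⟩]
    · obtain rfl : a = (1 + i) / 2 := by linear_combination ha / 2
      obtain rfl : b = (1 - i) / 2 := by linear_combination hab
      rcases h with rfl | rfl
      exacts [⟨1, rfl⟩, ⟨3, rfl⟩]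
  · rcases eq_tableC_or_tableD hp h1 h2 h3 h4 with rfl | rfl
    exacts [⟨4, rfl⟩, ⟨5, rfl⟩]

end Solutions

end H8

end

/-- The set of matched pairs of actions `(⇀, ↼)` on `H₈` has exactly six elements; they are the
pairs formed by one of the six tabulated left actions `⇀` and the right action
`x ↼ y = S(x₁ ⇀ y₁) x₂ y₂` it determines. -/
theorem theorem2p2 {k : Type*} [Field k] [IsAlgClosed k] [CharZero k] (i : k) (hi : i ^ 2 = -1) :
    {p : (H8 k →ₗ[k] H8 k →ₗ[k] H8 k) × (H8 k →ₗ[k] H8 k →ₗ[k] H8 k) |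
        IsMatchedPairOfActions k p.1 p.2} =
      Set.range (fun c : Fin 6 => (H8.leftAction i c, inducedRight k (H8.leftAction i c))) ∧
    {p : (H8 k →ₗ[k] H8 k →ₗ[k] H8 k) × (H8 k →ₗ[k] H8 k →ₗ[k] H8 k) |
        IsMatchedPairOfActions k p.1 p.2}.ncard = 6 := by
  -- The six pairs `(charLeft, charRight)` are distinct elements of `S`, and `S` is contained in the
  -- range of `f`, which has at most six elements. So both sets have six elements and agree; which
  -- `charLeft` is which `leftAction` need not be known.
  set S := {p : (H8 k →ₗ[k] H8 k →ₗ[k] H8 k) × (H8 k →ₗ[k] H8 k →ₗ[k] H8 k) |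
        IsMatchedPairOfActions k p.1 p.2}
  set f := fun c : Fin 6 => (H8.leftAction i c, inducedRight k (H8.leftAction i c))
  have hSf : S ⊆ Set.range f := by
    rintro ⟨l, r⟩ hp
    obtain ⟨c, hc⟩ := H8.exists_eq_leftAction hi hp
    exact ⟨c, Prod.ext hc.symm ((IsMatchedPairOfActions.eq_inducedRight hp).trans
      (congrArg _ hc)).symm⟩
  have hf : (Set.range f).ncard ≤ 6 := by
    rw [← Set.image_univ]
    exact (Set.ncard_image_le Set.finite_univ).trans (by simp [Set.ncard_univ])
  have hS : 6 ≤ S.ncard := by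
    have hinj : Function.Injective fun c => (H8.charLeft i c, H8.charRight i c) :=
      fun c c' h => H8.charLeft_injective hi (congrArg Prod.fst h)
    have hsub : Set.range (fun c => (H8.charLeft i c, H8.charRight i c)) ⊆ S := by
      rintro _ ⟨c, rfl⟩
      exact H8.isMatchedPairOfActions_char hi c
    calc 6 = (Set.range fun c => (H8.charLeft i c, H8.charRight i c)).ncard := by
          rw [← Set.image_univ, Set.ncard_image_of_injective _ hinj]
          simp [Set.ncard_univ]
      _ ≤ S.ncard := Set.ncard_le_ncard hsub ((Set.finite_range f).subset hSf)
  have h : S = Set.range f :=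
    Set.eq_of_subset_of_ncard_le hSf (hf.trans hS) (Set.finite_range f)
  exact ⟨h, le_antisymm (h ▸ hf) hS⟩
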